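/- Let $n\ge 1$ and let $\mathbb B^n=\{z\in\mathbb C^n:\|z\|<1\}$ be the Euclidean unit ball. Let $S(\mathbb B^n)$ be the class of all injective holomorphic maps $f:\mathbb B^n\to\mathbb C^n$ with $f(0)=0$ and $df(0)=\mathrm{Id}$. A Loewner chain is a family $(f_t)_{t\ge0}$ of holomorphic maps $f_t:\mathbb B^n\to\mathbb C^n$ such that $e^{-t}f_t\in S(\mathbb B^n)$ for all $t\ge 0$ and $f_s(\mathbb B^n)\subseteq f_t(\mathbb B^n)$ whenever $0\le s\le t$; it is called normal if $\{e^{-t}f_t\}_{t\ge0}$ is a normal family, i.e. every sequence in this family has a subsequence converging locally uniformly on $\mathbb B^n$ to a map into $\mathbb C^n$. Let $S^0(\mathbb B^n)$ be the set of all $f\in S(\mathbb B^n)$ for which there is a normal Loewner chain $(f_t)_{t\ge0}$ with $f_0=f$. Let $f\in S^0(\mathbb B^n)$. Then for every $r\in(0,1)$ and every $z\in\mathbb C^n$ with $\|z\|\le r$, $$\|df(z)\|\le\frac{(1+\sqrt r)^2}{(1-r)^3},$$ where $\|\cdot\|$ on the left-hand side is the operator norm of linear maps $\mathbb C^n\to\mathbb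 C^n$ with respect to the Euclidean norm. -/

import Mathlib

open scoped NNReal

noncomputable section

/-- Complex Euclidean space `ℂⁿ`, with the norm induced by the standard Hermitian product. -/
abbrev Cn (n : ℕ) : Type := EuclideanSpace ℂ (Fin n)

/-- The open unit ball of `ℂⁿ`. -/
abbrev unitBall (n : ℕ) : Set (Cn n) := Metric.ball 0 1

/-- The class `S(𝔹ⁿ)` of normalized univalent maps. Maps on the ball are represented by functions
on `ℂⁿ`, of which only the values on the ball matter. -/
structure IsNormalizedUnivalent {n : ℕ} (f : Cn n → Cn n) : Prop where
  holomorphic : DifferentiableOn ℂ f (unitBall n)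
  univalent : Set.InjOn f (unitBall n)
  map_zero : f 0 = 0
  fderiv_zero : fderiv ℂ f 0 = ContinuousLinearMap.id ℂ (Cn n)

/-- A normal family of maps on `U` with values in `ℂⁿ`: every sequence in the family has a
subsequence that converges locally uniformly on `U` (to a map with values in `ℂⁿ`). -/
def IsNormalFamily {n : ℕ} (𝓕 : Set (Cn n → Cn n)) (U : Set (Cn n)) : Prop :=
  ∀ u : ℕ → Cn n → Cn n, (∀ k, u k ∈ 𝓕) →
    ∃ (φ : ℕ → ℕ) (g : Cn n → Cn n), StrictMono φ ∧
      TendstoLocallyUniformlyOn (fun k => u (φ k)) g Filter.atTop U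

/-- The rescaled map `e⁻ᵗ F_t`. -/
def rescaled {n : ℕ} (F : ℝ≥0 → Cn n → Cn n) (t : ℝ≥0) : Cn n → Cn n :=
  fun z => Real.exp (-(t : ℝ)) • F t z

/-- A Loewner chain `(F_t)_{t ≥ 0}` on the unit ball. -/
structure IsLoewnerChain {n : ℕ} (F : ℝ≥0 → Cn n → Cn n) : Prop where
  normalized : ∀ t, IsNormalizedUnivalent (rescaled F t)
  image_subset : ∀ s t, s ≤ t → F s '' unitBall n ⊆ F t '' unitBall n

/-- A normal Loewner chain. -/
structure IsNormalLoewnerChain {n : ℕ} (F : ℝ≥0 → Cn n → Cn n) : Prop extends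
    IsLoewnerChain F where
  normal : IsNormalFamily (Set.range (rescaled F)) (unitBall n)

/-- The class `S⁰(𝔹ⁿ)`: maps in `S(𝔹ⁿ)` that embed into a normal Loewner chain. -/
def classS0 (n : ℕ) : Set (Cn n → Cn n) :=
  {f | IsNormalizedUnivalent f ∧
    ∃ F : ℝ≥0 → Cn n → Cn n, IsNormalLoewnerChain F ∧ Set.EqOn (F 0) f (unitBall n)}

end

/-! The bound combines a growth theorem with a Schwarz–Pick estimate. If `‖f‖ ≤ M` on the ball of
radius `R`, then `‖df(z)‖ ≤ M * R / (R ^ 2 - ‖z‖ ^ 2)` (`norm_fderiv_mul_le_of_forall_mem_ball`).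
For `f ∈ S⁰` the growth theorem `‖f x‖ ≤ koebe ‖x‖` allows `M = koebe R`, and `R = √r` yields the
stated constant.

The growth theorem is proved without the Loewner differential equation. The transition map `v =
F_t⁻¹ ∘ F_s` is a self-map of the ball with `v 0 = 0` and `dv(0) = a • Id`, `a = e^(s-t)`.
Schwarz–Pick on complex lines through `0` shows that `koebe ‖·‖` shrinks under `v` by the factor
`((1 + a) / 2) ^ 2`, which is `e^(-τ + O(τ²))` for `τ = t - s`. Cutting `[0, t]` into ever smaller
equal pieces gives the factor `e^(-t)` (`koebe_norm_le_exp_neg`). Normality makes `e^(-t) F_t = id +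
O(‖·‖²)` near `0` uniformly in `t`, so letting `t → ∞` gives the estimate for `F_0`.

Transition maps are holomorphic by Osgood's theorem: injective holomorphic maps in equal dimensions
have invertible differentials. It is proved by induction on the dimension; the obstruction to be
excluded is a holomorphic curve along which the differential vanishes. -/

open scoped NNReal Topology
open Set Metric Filter

/-! ### Cauchy estimates and smoothness of holomorphic maps -/

section HolomorphicRegularity

variable {E F : Type*} [NormedAddCommGroup E] [NormedSpace ℂ E]
  [NormedAddCommGroup F] [NormedSpace ℂ F]

theorem norm_fderiv_le_of_forall_mem_ball {f : E → F} {x : E} {ρ M : ℝ} (hρ : 0 < ρ)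
    (hd : DifferentiableOn ℂ f (ball x ρ)) (hM : ∀ y ∈ ball x ρ, ‖f y‖ ≤ M) :
    ‖fderiv ℂ f x‖ ≤ 2 * M / ρ := by
  refine Complex.norm_fderiv_le_div_of_mapsTo_ball hd (fun y hy => ?_) hρ
  rw [mem_closedBall, dist_eq_norm]
  have h1 := hM y hy
  have h2 := hM x (mem_ball_self hρ)
  have := norm_sub_le (f y) (f x)
  linarith

/-- Higher-order Schwarz lemma for `f` minus its linear part: the increment is `o(‖y - x‖)` and
bounded by `M + 2M + M`. The constant depends only on `M` and `ρ`, hence serves whole families. -/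
theorem norm_sub_linear_le_of_forall_mem_ball {f : E → F} {x y : E} {ρ M : ℝ} (hρ : 0 < ρ)
    (hd : DifferentiableOn ℂ f (ball x ρ)) (hM : ∀ y ∈ ball x ρ, ‖f y‖ ≤ M)
    (hy : y ∈ ball x ρ) :
    ‖f y - f x - fderiv ℂ f x (y - x)‖ ≤ 4 * M * (‖y - x‖ / ρ) ^ 2 := by
  have hdx : DifferentiableAt ℂ f x := hd.differentiableAt (ball_mem_nhds _ hρ)
  have hbd := norm_fderiv_le_of_forall_mem_ball hρ hd hM
  have key := Complex.dist_le_mul_div_pow_of_mapsTo_ball_of_isLittleO (n := 1) (c := x) (z := y)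
    (R₁ := ρ) (R₂ := 4 * M) (f := fun y => f y - fderiv ℂ f x (y - x)) ?_ ?_ ?_ hy
  · simp only [dist_eq_norm, sub_self, map_zero, sub_zero] at key
    rwa [sub_right_comm] at key
  · exact hd.sub (by fun_prop)
  · intro w hw
    rw [mem_closedBall, dist_eq_norm]
    simp only [sub_self, map_zero, sub_zero]
    have h1 := hM w hw
    have h2 := hM x (mem_ball_self hρ)
    have h3 : ‖fderiv ℂ f x (w - x)‖ ≤ 2 * M := by
      have hwx : ‖w - x‖ ≤ ρ := by rw [mem_ball, dist_eq_norm] at hw; exact hw.le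
      calc _ ≤ ‖fderiv ℂ f x‖ * ‖w - x‖ := ContinuousLinearMap.le_opNorm _ _
        _ ≤ (2 * M / ρ) * ρ := by
          gcongr
          exact (norm_nonneg _).trans hbd
        _ = 2 * M := by field_simp
    have h4 := norm_sub_le (f w - fderiv ℂ f x (w - x)) (f x)
    have h5 := norm_sub_le (f w) (fderiv ℂ f x (w - x))
    linarith
  · have := hdx.hasFDerivAt.isLittleO
    simp only [pow_one, sub_self, map_zero, sub_zero]
    refine (this.congr_left fun w => ?_).norm_right
    abel

/-- Cauchy estimates on the half-radius ball turn uniform closeness of the `q k` into a uniform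
Cauchy property of their derivatives. -/
theorem differentiableAt_of_uniform_approx [CompleteSpace F] {q : ℕ → E → F} {g : E → F} {x₀ : E}
    {R : ℝ} {b : ℕ → ℝ} (hR : 0 < R) (hq : ∀ k, DifferentiableOn ℂ (q k) (ball x₀ R))
    (hb : Tendsto b atTop (𝓝 0)) (hqg : ∀ k, ∀ x ∈ ball x₀ R, ‖q k x - g x‖ ≤ b k) :
    DifferentiableAt ℂ g x₀ := by
  have hsub : ∀ x ∈ ball x₀ (R / 2), ball x (R / 2) ⊆ ball x₀ R := by
    intro x hx
    apply ball_subset_ball'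
    rw [mem_ball] at hx
    linarith
  have hdiffat : ∀ k, ∀ x ∈ ball x₀ (R / 2), DifferentiableAt ℂ (q k) x := fun k x hx =>
    (hq k).differentiableAt (isOpen_ball.mem_nhds (hsub x hx (mem_ball_self (by positivity))))
  have hC : ∀ k l, ∀ x ∈ ball x₀ (R / 2),
      ‖fderiv ℂ (q k) x - fderiv ℂ (q l) x‖ ≤ 2 * (b k + b l) / (R / 2) := by
    intro k l x hx
    rw [← fderiv_sub (hdiffat k x hx) (hdiffat l x hx)]
    refine norm_fderiv_le_of_forall_mem_ball (by positivity)
      (((hq k).sub (hq l)).mono (hsub x hx)) fun y hy => ?_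
    have hy' := hsub x hx hy
    calc ‖q k y - q l y‖ = ‖(q k y - g y) - (q l y - g y)‖ := by congr 1; abel
      _ ≤ _ := (norm_sub_le _ _).trans (add_le_add (hqg k y hy') (hqg l y hy'))
  have hcau : UniformCauchySeqOn (fun k => fderiv ℂ (q k)) atTop (ball x₀ (R / 2)) := by
    rw [Metric.uniformCauchySeqOn_iff]
    intro ε hε
    have hlim : Tendsto (fun k => 2 * b k / (R / 2)) atTop (𝓝 0) := by
      simpa using (hb.const_mul 2).div_const (R / 2)
    obtain ⟨N, hN⟩ := eventually_atTop.1 (hlim.eventually_lt_const (half_pos hε))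
    refine ⟨N, fun k hk l hl x hx => ?_⟩
    rw [dist_eq_norm]
    have h1 := hN k hk
    have h2 := hN l hl
    refine (hC k l x hx).trans_lt ?_
    have : 2 * (b k + b l) / (R / 2) = 2 * b k / (R / 2) + 2 * b l / (R / 2) := by ring
    linarith
  have hlim : ∀ x ∈ ball x₀ (R / 2), ∃ L, Tendsto (fun k => fderiv ℂ (q k) x) atTop (𝓝 L) :=
    fun x hx => cauchySeq_tendsto_of_complete (hcau.cauchySeq hx)
  choose! g' hg' using hlim
  have hu := hcau.tendstoUniformlyOn_of_tendsto hg'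
  refine (hasFDerivAt_of_tendstoUniformlyOn isOpen_ball hu
    (fun k x hx => (hdiffat k x hx).hasFDerivAt) (fun x hx => ?_)
    (mem_ball_self (by positivity : 0 < R / 2))).differentiableAt
  rw [tendsto_iff_norm_sub_tendsto_zero]
  exact squeeze_zero (fun _ => norm_nonneg _)
    (fun k => hqg k x (hsub x hx (mem_ball_self (by positivity)))) hb

/-- The difference quotients of `f` along `u` are holomorphic and, by the second-order bound,
converge locally uniformly to the directional derivative. -/
theorem DifferentiableOn.fderiv_apply_const [CompleteSpace F] {f : E → F} {U : Set E}
    (hU : IsOpen U) (hf : DifferentiableOn ℂ f U) (u : E) :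
    DifferentiableOn ℂ (fun x => fderiv ℂ f x u) U := by
  intro x₀ hx₀
  refine DifferentiableAt.differentiableWithinAt ?_
  have hcont : ContinuousAt f x₀ := (hf.differentiableAt (hU.mem_nhds hx₀)).continuousAt
  have hev : ∀ᶠ x in 𝓝 x₀, x ∈ U ∧ ‖f x‖ < ‖f x₀‖ + 1 :=
    (hU.eventually_mem hx₀).and (hcont.norm.eventually_lt_const (by linarith))
  obtain ⟨R, hR, hball⟩ := Metric.eventually_nhds_iff_ball.1 hev
  set M := ‖f x₀‖ + 1
  set ρ := R / 2 with hρ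
  have hρ0 : 0 < ρ := by positivity
  have hsub : ∀ x ∈ ball x₀ ρ, ball x ρ ⊆ ball x₀ R := by
    intro x hx
    apply ball_subset_ball'
    rw [mem_ball] at hx
    linarith
  -- The `+ 1` covers `u = 0` and makes `‖ε k • u‖ < ρ` strict.
  set c : ℝ := ρ / (‖u‖ + 1) with hc
  have hc0 : 0 < c := by positivity
  set ε : ℕ → ℂ := fun k => ((c / (k + 1) : ℝ) : ℂ) with hε
  have hεn : ∀ k, ‖ε k‖ = c / (k + 1) := by
    intro k
    rw [hε, Complex.norm_real, Real.norm_of_nonneg (by positivity)]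
  have hεpos : ∀ k, 0 < ‖ε k‖ := fun k => by rw [hεn]; positivity
  have hεu : ∀ k, ‖ε k • u‖ < ρ := by
    intro k
    rw [norm_smul, hεn]
    calc c / (k + 1) * ‖u‖ ≤ c / 1 * ‖u‖ := by
          gcongr
          linarith [(Nat.cast_nonneg k : (0 : ℝ) ≤ k)]
      _ < c * (‖u‖ + 1) := by rw [div_one]; gcongr; linarith
      _ = ρ := by rw [hc]; field_simp
  refine differentiableAt_of_uniform_approx (q := fun k x => (ε k)⁻¹ • (f (x + ε k • u) - f x))
    (R := ρ) (b := fun k => 4 * M * (‖u‖ / ρ) ^ 2 * (c / (k + 1))) hρ0 ?_ ?_ ?_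
  · intro k x hx
    have h1 : x + ε k • u ∈ ball x ρ := by simpa [mem_ball, dist_eq_norm] using hεu k
    have h2 : DifferentiableAt ℂ f (x + ε k • u) :=
      hf.differentiableAt (hU.mem_nhds (hball _ (hsub x hx h1)).1)
    have h3 : DifferentiableAt ℂ f x :=
      hf.differentiableAt (hU.mem_nhds (hball _ (hsub x hx (mem_ball_self hρ0))).1)
    have h4 : DifferentiableAt ℂ (fun y => f (y + ε k • u)) x :=
      DifferentiableAt.comp x (f := fun y => y + ε k • u) h2 (by fun_prop)
    exact ((h4.sub h3).const_smul _).differentiableWithinAt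
  · have h0 : Tendsto (fun k : ℕ => c / ((k : ℝ) + 1)) atTop (𝓝 0) :=
      tendsto_const_nhds.div_atTop
        (tendsto_atTop_add_const_right _ _ tendsto_natCast_atTop_atTop)
    simpa using h0.const_mul (4 * M * (‖u‖ / ρ) ^ 2)
  · intro k x hx
    have h1 : x + ε k • u ∈ ball x ρ := by simpa [mem_ball, dist_eq_norm] using hεu k
    have key := norm_sub_linear_le_of_forall_mem_ball hρ0
      (hf.mono fun y hy => (hball y (hsub x hx hy)).1)
      (fun y hy => (hball y (hsub x hx hy)).2.le) h1
    rw [add_sub_cancel_left, map_smul, norm_smul] at key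
    have hne : ε k ≠ 0 := norm_pos_iff.1 (hεpos k)
    have : (ε k)⁻¹ • (f (x + ε k • u) - f x) - fderiv ℂ f x u
        = (ε k)⁻¹ • (f (x + ε k • u) - f x - ε k • fderiv ℂ f x u) := by
      rw [smul_sub _ _ (ε k • _), inv_smul_smul₀ hne]
    rw [this, norm_smul, norm_inv, ← hεn k]
    calc ‖ε k‖⁻¹ * _ ≤ ‖ε k‖⁻¹ * (4 * M * (‖ε k‖ * ‖u‖ / ρ) ^ 2) := by gcongr
      _ = 4 * M * (‖u‖ / ρ) ^ 2 * ‖ε k‖ := by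
        have := (hεpos k).ne'
        field_simp

theorem DifferentiableOn.contDiffOn_nat [FiniteDimensional ℂ E] [CompleteSpace F] {f : E → F}
    {U : Set E} (hU : IsOpen U) (hf : DifferentiableOn ℂ f U) (n : ℕ) : ContDiffOn ℂ n f U := by
  induction n generalizing f with
  | zero => exact contDiffOn_zero.2 hf.continuousOn
  | succ n ih =>
    rw [Nat.cast_succ, contDiffOn_succ_iff_fderiv_of_isOpen hU]
    refine ⟨hf, by simp, ?_⟩
    rw [contDiffOn_clm_apply]
    exact fun u => ih (hf.fderiv_apply_const hU u)

end HolomorphicRegularity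

/-! ### Zeros of holomorphic functions of one and two variables -/

section ZeroSets

/-- Minimum modulus: without a zero, the maximum principle for `1 / h` would be violated at the
centre. -/
theorem exists_mem_ball_eq_zero_of_norm_lt {h : ℂ → ℂ} {b : ℂ} {ε c : ℝ} (hε : 0 < ε)
    (hd : DifferentiableOn ℂ h (closedBall b ε)) (hc : ∀ y ∈ sphere b ε, c ≤ ‖h y‖)
    (hb : ‖h b‖ < c) : ∃ y ∈ ball b ε, h y = 0 := by
  by_contra! hne
  have hc0 : 0 < c := (norm_nonneg _).trans_lt hb
  have hne' : ∀ y ∈ closedBall b ε, h y ≠ 0 := by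
    intro y hy
    rcases (mem_closedBall.1 hy).lt_or_eq with hlt | heq
    · exact hne y hlt
    · exact norm_pos_iff.1 (hc0.trans_le (hc y heq))
  have hinv : DifferentiableOn ℂ (fun y => (h y)⁻¹) (closedBall b ε) := hd.inv hne'
  have hle := Complex.norm_le_of_forall_mem_frontier_norm_le (C := c⁻¹) isBounded_ball
    (hinv.diffContOnCl_ball subset_rfl) (fun y hy => by
      rw [norm_inv]
      exact inv_anti₀ hc0 (hc y (frontier_ball_subset_sphere hy)))
    (subset_closure (mem_ball_self hε))
  rw [norm_inv] at hle
  exact absurd ((inv_le_inv₀ (norm_pos_iff.2 (hne b (mem_ball_self hε))) hc0).1 hle) hb.not_ge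

/-- Suppose `h' a = 0`. For `x` near `a`, `dslope h x` is small at `a` by symmetry of slopes, but
bounded below on a circle about `a`, so it has a zero inside. By injectivity that zero can only be
`x`, whence `h' x = 0`. Thus `h` is constant near `a`, a contradiction. -/
theorem deriv_ne_zero_of_injOn {h : ℂ → ℂ} {U : Set ℂ} (hU : IsOpen U)
    (hd : DifferentiableOn ℂ h U) (hinj : InjOn h U) {a : ℂ} (ha : a ∈ U) : deriv h a ≠ 0 := by
  intro h0
  obtain ⟨ε, hε, hball⟩ := Metric.nhds_basis_closedBall.mem_iff.1 (hU.mem_nhds ha)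
  have hdsl : ∀ x ∈ U, DifferentiableOn ℂ (dslope h x) U := fun x hx =>
    (Complex.differentiableOn_dslope (hU.mem_nhds hx)).2 hd
  have hslope_ne : ∀ x ∈ U, ∀ y ∈ U, y ≠ x → dslope h x y ≠ 0 := by
    intro x hx y hy hyx
    rw [dslope_of_ne _ hyx, slope_def_field]
    exact div_ne_zero (sub_ne_zero.2 fun e => hyx (hinj hy hx e)) (sub_ne_zero.2 hyx)
  obtain ⟨y₀, hy₀, hmin⟩ := (isCompact_sphere a ε).exists_isMinOn
    (NormedSpace.sphere_nonempty.2 hε.le)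
    ((hdsl a ha).continuousOn.norm.mono (sphere_subset_closedBall.trans hball))
  set c := ‖dslope h a y₀‖ with hc
  have hc0 : 0 < c := norm_pos_iff.2
    (hslope_ne a ha y₀ (hball (sphere_subset_closedBall hy₀)) (ne_of_mem_sphere hy₀ hε.ne'))
  have hev1 : ∀ᶠ x in 𝓝 a, ∀ y ∈ sphere a ε, c / 2 < ‖slope h x y‖ := by
    refine (isCompact_sphere a ε).eventually_forall_of_forall_eventually fun y hy => ?_
    have hya : y ≠ a := ne_of_mem_sphere hy hε.ne'
    have hyU : y ∈ U := hball (sphere_subset_closedBall hy)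
    have hval : c / 2 < ‖slope h a y‖ := by
      have : c ≤ ‖dslope h a y‖ := hmin hy
      rw [dslope_of_ne _ hya] at this
      linarith
    have hcont : ContinuousAt (fun z : ℂ × ℂ => ‖slope h z.1 z.2‖) (a, y) := by
      simp only [slope_def_field]
      have h1 : ContinuousAt (fun z : ℂ × ℂ => h z.1) (a, y) :=
        ContinuousAt.comp (f := Prod.fst) (hd.differentiableAt (hU.mem_nhds ha)).continuousAt
          continuousAt_fst
      have h2 : ContinuousAt (fun z : ℂ × ℂ => h z.2) (a, y) :=
        ContinuousAt.comp (f := Prod.snd) (hd.differentiableAt (hU.mem_nhds hyU)).continuousAt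
          continuousAt_snd
      exact ((h2.sub h1).div (continuousAt_snd.sub continuousAt_fst) (sub_ne_zero.2 hya)).norm
    exact hcont.eventually_const_lt hval
  have hev2 : ∀ᶠ x in 𝓝 a, ‖dslope h a x‖ < c / 2 := by
    refine ((hdsl a ha).differentiableAt (hU.mem_nhds ha)).continuousAt.norm.eventually_lt_const ?_
    simp only [dslope_same, h0, norm_zero]
    positivity
  have hev3 : ∀ᶠ x in 𝓝 a, deriv h x = 0 := by
    filter_upwards [hev1, hev2, hU.eventually_mem ha] with x hx1 hx2 hxU
    by_cases hxa : x = a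
    · rw [hxa, h0]
    -- A point `x` of the circle is ruled out by `hx1` at `y = x`, since `slope h x x` is `0` by
    -- convention.
    by_cases hxs : x ∈ sphere a ε
    · have := hx1 x hxs
      rw [slope_same, norm_zero] at this
      linarith
    obtain ⟨y, hy, hy0⟩ := exists_mem_ball_eq_zero_of_norm_lt (c := c / 2) hε
      ((hdsl x hxU).mono hball) (fun y hy => by
        have hyx : y ≠ x := by rintro rfl; exact hxs hy
        rw [dslope_of_ne _ hyx]
        exact (hx1 y hy).le) (by
        rw [dslope_of_ne _ (Ne.symm hxa), slope_comm, ← dslope_of_ne _ hxa]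
        exact hx2)
    have hyx : y = x := by
      by_contra hne
      exact hslope_ne x hxU y (hball (ball_subset_closedBall hy)) hne hy0
    rwa [hyx, dslope_same] at hy0
  obtain ⟨δ, hδ, hδball⟩ := Metric.eventually_nhds_iff_ball.1 (hev3.and (hU.eventually_mem ha))
  have hconst : ∀ x ∈ ball a δ, h x = h a := fun x hx =>
    isOpen_ball.is_const_of_deriv_eq_zero (convex_ball a δ).isPreconnected
      (hd.mono fun y hy => (hδball y hy).2) (fun y hy => (hδball y hy).1) hx (mem_ball_self hδ)
  have hmem : a + (δ / 2 : ℝ) ∈ ball a δ := by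
    rw [mem_ball, dist_eq_norm, add_sub_cancel_left, Complex.norm_real,
      Real.norm_of_nonneg (by positivity)]
    linarith
  have := hinj (hδball _ hmem).2 ha (hconst _ hmem)
  have h2 : ((δ / 2 : ℝ) : ℂ) = 0 := by simpa using this
  rw [Complex.ofReal_eq_zero] at h2
  linarith

/-- The `k`-fold partial derivative in the second variable. -/
noncomputable def partialSnd (g : ℂ × ℂ → ℂ) : ℕ → ℂ × ℂ → ℂ
  | 0 => g
  | k + 1 => fun q => fderiv ℂ (partialSnd g k) q (0, 1)

variable {g : ℂ × ℂ → ℂ} {U : Set (ℂ × ℂ)}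

theorem differentiableOn_partialSnd (hU : IsOpen U) (hg : DifferentiableOn ℂ g U) (k : ℕ) :
    DifferentiableOn ℂ (partialSnd g k) U := by
  induction k with
  | zero => exact hg
  | succ k ih => exact ih.fderiv_apply_const hU _

theorem partialSnd_eventuallyEq_iteratedDeriv (hU : IsOpen U) (hg : DifferentiableOn ℂ g U)
    {p : ℂ × ℂ} (hp : p ∈ U) (k : ℕ) :
    (fun y => partialSnd g k (p.1, y)) =ᶠ[𝓝 p.2] iteratedDeriv k (fun y => g (p.1, y)) := by
  induction k with
  | zero => simp [partialSnd, iteratedDeriv_zero]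
  | succ k ih =>
    have hcont : ContinuousAt (fun y : ℂ => (p.1, y)) p.2 := by fun_prop
    filter_upwards [ih.eventually_nhds, hcont.eventually (hU.eventually_mem hp)] with y hy hyU
    have hd := ((differentiableOn_partialSnd hU hg k).differentiableAt (hU.mem_nhds hyU)).hasFDerivAt
    have h1 : HasDerivAt (fun y : ℂ => (p.1, y)) ((0 : ℂ), (1 : ℂ)) y :=
      (hasDerivAt_const _ _).prodMk (hasDerivAt_id _)
    have h2 := hd.comp_hasDerivAt y h1
    rw [iteratedDeriv_succ, ← Filter.EventuallyEq.deriv_eq hy]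
    exact h2.deriv.symm

theorem analyticAt_snd_slice (hU : IsOpen U) (hg : DifferentiableOn ℂ g U) {p : ℂ × ℂ}
    (hp : p ∈ U) : AnalyticAt ℂ (fun y => g (p.1, y)) p.2 := by
  rw [Complex.analyticAt_iff_eventually_differentiableAt]
  have hcont : ContinuousAt (fun y : ℂ => (p.1, y)) p.2 := by fun_prop
  filter_upwards [hcont.eventually (hU.eventually_mem hp)] with y hyU
  exact DifferentiableAt.comp y (hg.differentiableAt (hU.mem_nhds hyU)) (by fun_prop)

theorem eventually_eq_zero_snd_slice_iff (hU : IsOpen U) (hg : DifferentiableOn ℂ g U) {p : ℂ × ℂ}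
    (hp : p ∈ U) : (∀ᶠ y in 𝓝 p.2, g (p.1, y) = 0) ↔ ∀ k, partialSnd g k p = 0 := by
  have hval : ∀ k, partialSnd g k p = iteratedDeriv k (fun y => g (p.1, y)) p.2 := fun k =>
    (partialSnd_eventuallyEq_iteratedDeriv hU hg hp k).self_of_nhds
  have han := analyticAt_snd_slice hU hg hp
  rw [← analyticOrderAt_eq_top, ENat.eq_top_iff_forall_ge]
  simp_rw [natCast_le_analyticOrderAt_iff_iteratedDeriv_eq_zero han, hval]
  exact ⟨fun h k => h (k + 1) k (Nat.lt_succ_self k), fun h k i _ => h i⟩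

/-- The zero set of a holomorphic function of two variables contains a holomorphic graph. -/
theorem exists_graph_subset_zeros (hU : IsOpen U) (hg : DifferentiableOn ℂ g U) {p : ℂ × ℂ}
    (hp : p ∈ U) (hp0 : g p = 0) (hnz : ¬ ∀ᶠ y in 𝓝 p.2, g (p.1, y) = 0) :
    ∃ (x₀ : ℂ) (γ : ℂ → ℂ), ∀ᶠ x in 𝓝 x₀,
      DifferentiableAt ℂ γ x ∧ (x, γ x) ∈ U ∧ g (x, γ x) = 0 := by
  classical
  -- The least such `k`, taken over all zeros in `U`, is some `m + 1`. Then `partialSnd g m`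
  -- vanishes at every zero of `g` in `U`, while its `y`-derivative is nonzero at `q`: near `q` the
  -- zeros of `g` lie on the implicit graph of `partialSnd g m = 0`.
  have hex : ∃ k, ∃ q ∈ U, g q = 0 ∧ partialSnd g k q ≠ 0 := by
    rw [eventually_eq_zero_snd_slice_iff hU hg hp] at hnz
    push Not at hnz
    obtain ⟨k, hk⟩ := hnz
    exact ⟨k, p, hp, hp0, hk⟩
  obtain ⟨q, hq, hq0, hqm⟩ := Nat.find_spec hex
  have hmin : ∀ k < Nat.find hex, ∀ q ∈ U, g q = 0 → partialSnd g k q = 0 := by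
    intro k hk q' hq' hq'0
    by_contra hne
    exact Nat.find_min hex hk ⟨q', hq', hq'0, hne⟩
  obtain ⟨m, hm⟩ : ∃ m, Nat.find hex = m + 1 := by
    refine Nat.exists_eq_succ_of_ne_zero fun h0 => ?_
    rw [h0] at hqm
    exact hqm hq0
  rw [hm] at hqm hmin
  have hGd := differentiableOn_partialSnd hU hg m
  have hGc : ContDiffAt ℂ (1 : ℕ) (partialSnd g m) q :=
    (hGd.contDiffOn_nat hU 1).contDiffAt (hU.mem_nhds hq)
  have hinv : (fderiv ℂ (partialSnd g m) q ∘L .inr ℂ ℂ ℂ).IsInvertible := by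
    refine ⟨ContinuousLinearEquiv.unitsEquivAut ℂ (Units.mk0 _ hqm), ?_⟩
    ext
    simp [partialSnd]
  have hnz' : ¬ ∀ᶠ y in 𝓝 q.2, g (q.1, y) = 0 := by
    rw [eventually_eq_zero_snd_slice_iff hU hg hq]
    exact fun h => hqm (h _)
  have hiso : ∀ᶠ y in 𝓝[≠] q.2, g (q.1, y) ≠ 0 :=
    (analyticAt_snd_slice hU hg hq).eventually_eq_zero_or_eventually_ne_zero.resolve_left hnz'
  have hone : ((1 : ℕ) : WithTop ℕ∞) ≠ 0 := by simp
  set ψ := hGc.implicitFunction hone hinv with hψ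
  have hiff := hGc.eventually_apply_eq_iff_implicitFunction hone hinv
  have hGq : partialSnd g m q = 0 := hmin m (Nat.lt_succ_self m) q hq hq0
  rw [← hψ, hGq] at hiff
  have hψc : ContDiffAt ℂ (1 : ℕ) ψ q.1 := hGc.contDiffAt_implicitFunction hone hinv
  obtain ⟨δ, hδ, hδball⟩ := Metric.eventually_nhds_iff_ball.1 (hiff.and (hU.eventually_mem hq))
  obtain ⟨ε', hε', hε'ball⟩ := Metric.eventually_nhds_iff_ball.1 (eventually_nhdsWithin_iff.1 hiso)
  set ε := min (δ / 2) (ε' / 2) with hεdef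
  have hε : 0 < ε := by positivity
  have hεδ : ε < δ := (min_le_left _ _).trans_lt (by linarith)
  have hεε' : ε < ε' := (min_le_right _ _).trans_lt (by linarith)
  have hmemU : ∀ x ∈ ball q.1 δ, ∀ y ∈ closedBall q.2 ε, (x, y) ∈ ball q δ := by
    intro x hx y hy
    rw [mem_ball, Prod.dist_eq]
    exact max_lt hx ((mem_closedBall.1 hy).trans_lt hεδ)
  have hsliced : ∀ x ∈ ball q.1 δ, DifferentiableOn ℂ (fun y => g (x, y)) (closedBall q.2 ε) :=
    fun x hx y hy => (DifferentiableAt.comp y (hg.differentiableAt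
      (hU.mem_nhds (hδball _ (hmemU x hx y hy)).2)) (by fun_prop)).differentiableWithinAt
  obtain ⟨y₀, hy₀, hymin⟩ := (isCompact_sphere q.2 ε).exists_isMinOn
    (NormedSpace.sphere_nonempty.2 hε.le)
    ((hsliced q.1 (mem_ball_self hδ)).continuousOn.norm.mono sphere_subset_closedBall)
  set c := ‖g (q.1, y₀)‖ with hc
  have hc0 : 0 < c := norm_pos_iff.2 (hε'ball y₀ ((mem_sphere.1 hy₀).trans_lt hεε')
    (ne_of_mem_sphere hy₀ hε.ne'))
  have hev1 : ∀ᶠ x in 𝓝 q.1, ∀ y ∈ sphere q.2 ε, c / 2 < ‖g (x, y)‖ := by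
    refine (isCompact_sphere q.2 ε).eventually_forall_of_forall_eventually fun y hy => ?_
    have hyU := (hδball _ (hmemU q.1 (mem_ball_self hδ) y (sphere_subset_closedBall hy))).2
    have hle : c ≤ ‖g (q.1, y)‖ := hymin hy
    exact (hg.differentiableAt (hU.mem_nhds hyU)).continuousAt.norm.eventually_const_lt
      (by linarith)
  have hev2 : ∀ᶠ x in 𝓝 q.1, ‖g (x, q.2)‖ < c / 2 := by
    have hcont : ContinuousAt (fun x => g (x, q.2)) q.1 :=
      ContinuousAt.comp (f := fun x : ℂ => (x, q.2))
        (hg.differentiableAt (hU.mem_nhds hq)).continuousAt (by fun_prop)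
    refine hcont.norm.eventually_lt_const ?_
    simp only [Prod.mk.eta, hq0, norm_zero]
    positivity
  refine ⟨q.1, ψ, ?_⟩
  filter_upwards [hev1, hev2, ball_mem_nhds q.1 hδ, hψc.eventually (by simp)]
    with x hx1 hx2 hxδ hψx
  -- Conversely, each vertical slice near `q` contains a zero of `g`, which must be the point of the
  -- graph; so the whole graph consists of zeros.
  obtain ⟨y, hy, hgy⟩ := exists_mem_ball_eq_zero_of_norm_lt hε (hsliced x hxδ)
    (fun y hy => (hx1 y hy).le) hx2
  obtain ⟨hiffy, hyU⟩ := hδball _ (hmemU x hxδ y (ball_subset_closedBall hy))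
  have hψy : ψ x = y := hiffy.1 (hmin m (Nat.lt_succ_self m) _ hyU hgy)
  rw [hψy]
  exact ⟨hψx.differentiableAt hone, hyU, hgy⟩

end ZeroSets

/-! ### Restriction to complex lines -/

section Slices

variable {E F : Type*} [NormedAddCommGroup E] [NormedSpace ℂ E]
  [NormedAddCommGroup F] [NormedSpace ℂ F]

/-- If `J` vanished near `a` on every complex line, the identity theorem on line slices of a ball
would give `J = 0` on that ball. -/
theorem exists_direction_not_eventually_zero {J : E → ℂ} {U : Set E} (hU : IsOpen U)
    (hJ : DifferentiableOn ℂ J U) {a : E} (ha : a ∈ U) (hnz : ¬ ∀ᶠ z in 𝓝 a, J z = 0) :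
    ∃ v, ¬ ∀ᶠ y : ℂ in 𝓝 0, J (a + y • v) = 0 := by
  obtain ⟨R, hR, hball⟩ := Metric.isOpen_iff.1 hU a ha
  by_contra! hall
  refine hnz (Metric.eventually_nhds_iff_ball.2 ⟨R, hR, fun z hz => ?_⟩)
  have hlin : Continuous fun y : ℂ => a + y • (z - a) := by fun_prop
  set V : Set ℂ := (fun y : ℂ => a + y • (z - a)) ⁻¹' ball a R with hV
  have hVo : IsOpen V := isOpen_ball.preimage hlin
  have hVeq : V = (fun y : ℂ => y • (z - a)) ⁻¹' ball 0 R := by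
    ext y
    simp [hV, mem_ball, dist_eq_norm]
  have hVc : Convex ℝ V := by
    rw [hVeq]
    exact (convex_ball (0 : E) R).is_linear_preimage
      ⟨fun x y => add_smul x y _, fun c x => smul_assoc c x _⟩
  have han : AnalyticOnNhd ℂ (fun y : ℂ => J (a + y • (z - a))) V :=
    DifferentiableOn.analyticOnNhd ((hJ.mono hball).comp (by fun_prop) fun y hy => hy) hVo
  have h0 : (0 : ℂ) ∈ V := by simpa [hV] using hR
  have h1 : (1 : ℂ) ∈ V := by simpa [hV] using hz
  have := han.eqOn_zero_of_preconnected_of_eventuallyEq_zero hVc.isPreconnected h0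
    (hall (z - a)) h1
  simpa using this

theorem not_eventually_fderiv_eq_zero [Nontrivial E] {f : E → F} {U : Set E} (hU : IsOpen U)
    (hf : DifferentiableOn ℂ f U) (hinj : InjOn f U) {a : E} (ha : a ∈ U) :
    ¬ ∀ᶠ z in 𝓝 a, fderiv ℂ f z = 0 := by
  intro hev
  obtain ⟨δ, hδ, hball⟩ := Metric.eventually_nhds_iff_ball.1 (hev.and (hU.eventually_mem ha))
  obtain ⟨w, hw⟩ := exists_ne (0 : E)
  set v : E := ((δ / 2 / ‖w‖ : ℝ) : ℂ) • w with hv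
  have hwn : 0 < ‖w‖ := norm_pos_iff.2 hw
  have hvn : ‖v‖ = δ / 2 := by
    rw [hv, norm_smul, Complex.norm_real, Real.norm_of_nonneg (by positivity)]
    field_simp
  have hmem : a + v ∈ ball a δ := by
    rw [mem_ball, dist_eq_norm, add_sub_cancel_left, hvn]
    linarith
  have hc : f (a + v) = f a :=
    isOpen_ball.is_const_of_fderiv_eq_zero (𝕜 := ℂ) (convex_ball a δ).isPreconnected
      (hf.mono fun y hy => (hball y hy).2) (fun y hy => (hball y hy).1) hmem (mem_ball_self hδ)
  have := hinj (hball _ hmem).2 ha hc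
  rw [add_eq_left] at this
  rw [this, norm_zero] at hvn
  linarith

end Slices

/-! ### Osgood's theorem -/

section Osgood

universe u

/-- In dimension `n`, injective holomorphic maps have injective differentials. -/
def InjectiveDifferentials (n : ℕ) : Prop :=
  ∀ (E F : Type u) [NormedAddCommGroup E] [NormedSpace ℂ E] [FiniteDimensional ℂ E]
    [NormedAddCommGroup F] [NormedSpace ℂ F] [FiniteDimensional ℂ F],
    Module.finrank ℂ E = n → Module.finrank ℂ F = n →
    ∀ (f : E → F) (U : Set E), IsOpen U → DifferentiableOn ℂ f U → InjOn f U →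
    ∀ a ∈ U, Function.Injective (fderiv ℂ f a)

variable {E F : Type u} [NormedAddCommGroup E] [NormedSpace ℂ E] [FiniteDimensional ℂ E]
  [NormedAddCommGroup F] [NormedSpace ℂ F] [FiniteDimensional ℂ F]

/-- Take a functional `ℓ` with `lam = ℓ ∘ df(a) ≠ 0`. By the implicit function theorem the level set
of `ℓ ∘ f` through `a` is locally a graph over `K = ker lam`, tangent to `K`. There `f - f a` maps
injectively into `ker ℓ`, one dimension lower, so induction makes `df(a)` injective on `K`; and `ker
df(a) ⊆ K`. -/
theorem injective_fderiv_of_fderiv_ne_zero {n : ℕ} (ih : InjectiveDifferentials.{u} n)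
    (hE : Module.finrank ℂ E = n + 1) (hF : Module.finrank ℂ F = n + 1) {f : E → F} {U : Set E}
    (hU : IsOpen U) (hf : DifferentiableOn ℂ f U) (hinj : InjOn f U) {a : E} (ha : a ∈ U)
    (hne : fderiv ℂ f a ≠ 0) : Function.Injective (fderiv ℂ f a) := by
  obtain ⟨u₀, hu₀⟩ : ∃ u₀, fderiv ℂ f a u₀ ≠ 0 := by
    by_contra! h
    exact hne (ContinuousLinearMap.ext h)
  obtain ⟨ℓ, hℓ⟩ := SeparatingDual.exists_eq_one (R := ℂ) hu₀
  set lam : E →L[ℂ] ℂ := ℓ ∘L fderiv ℂ f a with hlam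
  have hlu : lam u₀ = 1 := hℓ
  have hlam0 : (lam : E →ₗ[ℂ] ℂ) ≠ 0 := by
    intro h
    have : lam u₀ = 0 := LinearMap.congr_fun h u₀
    rw [hlu] at this
    exact one_ne_zero this
  have hℓ0 : (ℓ : F →ₗ[ℂ] ℂ) ≠ 0 := by
    intro h
    have : ℓ (fderiv ℂ f a u₀) = 0 := LinearMap.congr_fun h _
    rw [hℓ] at this
    exact one_ne_zero this
  set K : Submodule ℂ E := LinearMap.ker (lam : E →ₗ[ℂ] ℂ) with hK
  set K' : Submodule ℂ F := LinearMap.ker (ℓ : F →ₗ[ℂ] ℂ) with hK'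
  have hKn : Module.finrank ℂ K = n := by
    have : Module.finrank ℂ K + 1 = Module.finrank ℂ E :=
      Module.Dual.finrank_ker_add_one_of_ne_zero hlam0
    omega
  have hK'n : Module.finrank ℂ K' = n := by
    have : Module.finrank ℂ K' + 1 = Module.finrank ℂ F :=
      Module.Dual.finrank_ker_add_one_of_ne_zero hℓ0
    omega
  obtain ⟨π₀, hπ₀⟩ := K'.subtype.exists_leftInverse_of_injective K'.ker_subtype
  set π : F →L[ℂ] K' := LinearMap.toContinuousLinearMap π₀ with hπ
  have hπK : ∀ y (hy : y ∈ K'), π y = ⟨y, hy⟩ := fun y hy => LinearMap.congr_fun hπ₀ ⟨y, hy⟩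
  -- coordinates `(k, t) ↦ a + k + t u₀` adapted to the kernel
  set A : K × ℂ →L[ℂ] E :=
    K.subtypeL ∘L .fst ℂ K ℂ + (ContinuousLinearMap.toSpanSingleton ℂ u₀) ∘L .snd ℂ K ℂ with hA
  have hAapp : ∀ k t, A (k, t) = (k : E) + t • u₀ := fun k t => by simp [hA]
  have hlamA : ∀ k t, lam (A (k, t)) = t := by
    intro k t
    have hk : lam (k : E) = 0 := k.2
    rw [hAapp, map_add, map_smul, hk, hlu, zero_add, smul_eq_mul, mul_one]
  have hAinj : Function.Injective A := by
    rintro ⟨k, t⟩ ⟨k', t'⟩ h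
    have ht : t = t' := by rw [← hlamA k t, h, hlamA]
    subst ht
    rw [hAapp, hAapp, add_left_inj] at h
    rw [Subtype.ext h]
  set W : Set (K × ℂ) := (fun p => a + A p) ⁻¹' U with hW
  have hWo : IsOpen W := hU.preimage (by fun_prop)
  have h0W : (0 : K × ℂ) ∈ W := by simpa [hW] using ha
  have hfA : DifferentiableOn ℂ (fun p => f (a + A p)) W :=
    hf.comp (by fun_prop) (fun p hp => hp)
  have hfA0 : HasFDerivAt (fun p => f (a + A p)) (fderiv ℂ f a ∘L A) 0 := by
    have h1 : HasFDerivAt (fun p => a + A p) A 0 := A.hasFDerivAt.const_add a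
    have h2 : HasFDerivAt f (fderiv ℂ f a) (a + A 0) := by
      rw [map_zero, add_zero]
      exact (hf.differentiableAt (hU.mem_nhds ha)).hasFDerivAt
    exact h2.comp 0 h1
  set G : K × ℂ → ℂ := fun p => ℓ (f (a + A p)) with hG
  have hGd : DifferentiableOn ℂ G W := ℓ.differentiable.comp_differentiableOn hfA
  have hGc : ContDiffAt ℂ (1 : ℕ) G 0 := (hGd.contDiffOn_nat hWo 1).contDiffAt (hWo.mem_nhds h0W)
  have hGf : HasFDerivAt G (lam ∘L A) 0 := ℓ.hasFDerivAt.comp 0 hfA0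
  have hinv : (fderiv ℂ G 0 ∘L .inr ℂ K ℂ).IsInvertible := by
    refine ⟨ContinuousLinearEquiv.refl ℂ ℂ, ?_⟩
    ext
    rw [hGf.fderiv]
    simp [hlamA]
  have hone : ((1 : ℕ) : WithTop ℕ∞) ≠ 0 := by simp
  set ψ : K → ℂ := hGc.implicitFunction hone hinv with hψ
  have hψ0 : ψ 0 = 0 := hGc.implicitFunction_apply_self hone hinv
  have hψc : ContDiffAt ℂ (1 : ℕ) ψ 0 := hGc.contDiffAt_implicitFunction hone hinv
  have hψG : ∀ᶠ k in 𝓝 (0 : K), G (k, ψ k) = G 0 :=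
    hGc.eventually_apply_implicitFunction hone hinv
  have hψd : ∀ᶠ k in 𝓝 (0 : K), DifferentiableAt ℂ ψ k :=
    (hψc.eventually (by simp)).mono fun k hk => hk.differentiableAt hone
  have hψW : ∀ᶠ k in 𝓝 (0 : K), (k, ψ k) ∈ W := by
    have hc : ContinuousAt (fun k => (k, ψ k)) (0 : K) := continuousAt_id.prodMk hψc.continuousAt
    refine hc.eventually (hWo.eventually_mem ?_)
    change ((0 : K), ψ 0) ∈ W
    rw [hψ0]
    exact h0W
  obtain ⟨δ, hδ, hball⟩ := Metric.eventually_nhds_iff_ball.1 (hψG.and (hψd.and hψW))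
  set h : K → K' := fun k => π (f (a + A (k, ψ k)) - f a) with hh
  have hmemK' : ∀ k ∈ ball (0 : K) δ, f (a + A (k, ψ k)) - f a ∈ K' := by
    intro k hk
    have := (hball k hk).1
    simp only [hG, map_zero, add_zero] at this
    rw [hK', LinearMap.mem_ker, ContinuousLinearMap.coe_coe, map_sub, this, sub_self]
  have hhd : DifferentiableOn ℂ h (ball 0 δ) := by
    intro k hk
    have h1 : DifferentiableAt ℂ (fun k => (k, ψ k)) k :=
      differentiableAt_id.prodMk (hball k hk).2.1
    have h2 : DifferentiableAt ℂ (fun p => f (a + A p)) (k, ψ k) :=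
      hfA.differentiableAt (hWo.mem_nhds (hball k hk).2.2)
    have h3 : DifferentiableAt ℂ (fun k => f (a + A (k, ψ k))) k :=
      DifferentiableAt.comp k (f := fun k => (k, ψ k)) h2 h1
    exact (π.differentiableAt.comp k (h3.sub_const (f a))).differentiableWithinAt
  have hhinj : InjOn h (ball 0 δ) := by
    intro k hk k' hk' he
    simp only [hh, hπK _ (hmemK' k hk), hπK _ (hmemK' k' hk'), Subtype.mk.injEq, sub_left_inj] at he
    have := hinj (hball k hk).2.2 (hball k' hk').2.2 he
    exact congrArg Prod.fst (hAinj (add_left_cancel this))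
  have hhI := ih K K' hKn hK'n h (ball 0 δ) isOpen_ball hhd hhinj 0 (mem_ball_self hδ)
  -- the graph is tangent to the kernel at the origin
  have hψf := (hψc.differentiableAt hone).hasFDerivAt
  have hgr : HasFDerivAt (fun k => (k, ψ k)) ((ContinuousLinearMap.id ℂ K).prod (fderiv ℂ ψ 0)) 0 :=
    (hasFDerivAt_id _).prodMk hψf
  have hgr0 : ((0 : K), ψ 0) = 0 := by rw [hψ0]; rfl
  have hψ'0 : ∀ k, fderiv ℂ ψ 0 k = 0 := by
    intro k
    have h1 : HasFDerivAt (fun k => G (k, ψ k))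
        ((lam ∘L A) ∘L (ContinuousLinearMap.id ℂ K).prod (fderiv ℂ ψ 0)) 0 :=
      HasFDerivAt.comp (g := G) (f := fun k => (k, ψ k)) (0 : K) (by rw [hgr0]; exact hGf) hgr
    have h2 : HasFDerivAt (fun k => G (k, ψ k)) (0 : K →L[ℂ] ℂ) 0 :=
      (hasFDerivAt_const (G 0) (0 : K)).congr_of_eventuallyEq hψG
    have := DFunLike.congr_fun (h1.unique h2) k
    simpa [hlamA] using this
  have hhf : HasFDerivAt h
      (π ∘L ((fderiv ℂ f a ∘L A) ∘L (ContinuousLinearMap.id ℂ K).prod (fderiv ℂ ψ 0))) 0 :=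
    π.hasFDerivAt.comp 0 ((HasFDerivAt.comp (g := fun p => f (a + A p)) (f := fun k => (k, ψ k)) (0 : K)
      (by rw [hgr0]; exact hfA0) hgr).sub_const (f a))
  rw [hhf.fderiv] at hhI
  rw [injective_iff_map_eq_zero]
  intro w hw
  have hwK : w ∈ K := by
    rw [hK, LinearMap.mem_ker, ContinuousLinearMap.coe_coe, hlam, ContinuousLinearMap.comp_apply,
      hw, map_zero]
  have : (⟨w, hwK⟩ : K) = 0 := by
    apply hhI
    rw [map_zero]
    simp [hψ'0, hAapp, hw]
  exact congrArg Subtype.val this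

/-- By `hrank`, the Jacobian determinant `J` vanishes only where `df = 0`, and `J` is not locally
zero since `f` is not locally constant. If `J a = 0`, the zero set of `J` in a suitable plane
through `a` contains a holomorphic curve; along it `f` has zero derivative and is constant, against
injectivity. -/
theorem fderiv_ne_zero_of_injOn_of_two_le (hE : 2 ≤ Module.finrank ℂ E)
    (hEF : Module.finrank ℂ E = Module.finrank ℂ F) {f : E → F} {U : Set E}
    (hU : IsOpen U) (hf : DifferentiableOn ℂ f U) (hinj : InjOn f U)
    (hrank : ∀ z ∈ U, fderiv ℂ f z ≠ 0 → Function.Injective (fderiv ℂ f z)) {a : E} (ha : a ∈ U) :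
    fderiv ℂ f a ≠ 0 := by
  intro hfa
  have : Nontrivial E := Module.nontrivial_of_finrank_pos (R := ℂ) (by omega)
  set L : F ≃L[ℂ] E := ContinuousLinearEquiv.ofFinrankEq hEF.symm with hL
  set J : E → ℂ := fun z => ContinuousLinearMap.det ((L : F →L[ℂ] E) ∘L fderiv ℂ f z) with hJdef
  have hJzero : ∀ z ∈ U, J z = 0 → fderiv ℂ f z = 0 := by
    intro z hz hJz
    by_contra hne
    have hi := hrank z hz hne
    have hi' : Function.Injective (((L : F →L[ℂ] E) ∘L fderiv ℂ f z : E →L[ℂ] E) : E →ₗ[ℂ] E) :=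
      L.injective.comp hi
    have hk := LinearMap.ker_eq_bot.2 hi'
    exact (LinearMap.isUnit_iff_isUnit_det _).1 ((LinearMap.isUnit_iff_ker_eq_bot _).2 hk)
      |>.ne_zero hJz
  have hJd : DifferentiableOn ℂ J U := by
    set b := Module.finBasis ℂ E
    have hJm : ∀ z, J z = Matrix.det (LinearMap.toMatrix b b
        (((L : F →L[ℂ] E) ∘L fderiv ℂ f z : E →L[ℂ] E) : E →ₗ[ℂ] E)) := fun z =>
      (LinearMap.det_toMatrix b _).symm
    have hentry : ∀ i j, DifferentiableOn ℂ (fun z => (LinearMap.toMatrix b b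
        (((L : F →L[ℂ] E) ∘L fderiv ℂ f z : E →L[ℂ] E) : E →ₗ[ℂ] E)) i j) U := by
      intro i j
      simp only [LinearMap.toMatrix_apply]
      set c : E →L[ℂ] ℂ := LinearMap.toContinuousLinearMap (b.coord i)
      exact (c ∘L (L : F →L[ℂ] E)).differentiable.comp_differentiableOn
        (hf.fderiv_apply_const hU (b j))
    rw [funext hJm]
    simp only [Matrix.det_apply]
    exact DifferentiableOn.fun_sum fun σ _ =>
      DifferentiableOn.const_smul (fun z hz => (HasFDerivWithinAt.finsetProd
        fun i _ => (hentry (σ i) i z hz).hasFDerivWithinAt).differentiableWithinAt) _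
  have hJa : J a = 0 := by
    simp only [hJdef, hfa, ContinuousLinearMap.comp_zero]
    change LinearMap.det ((0 : E →L[ℂ] E) : E →ₗ[ℂ] E) = 0
    rw [ContinuousLinearMap.toLinearMap_zero, LinearMap.det_zero, zero_pow (by omega)]
  have hJnz : ¬ ∀ᶠ z in 𝓝 a, J z = 0 := fun hev =>
    not_eventually_fderiv_eq_zero hU hf hinj ha
      ((hev.and (hU.eventually_mem ha)).mono fun z hz => hJzero z hz.2 hz.1)
  obtain ⟨v, hv⟩ := exists_direction_not_eventually_zero hU hJd ha hJnz
  have hv0 : v ≠ 0 := by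
    rintro rfl
    exact hv (by simp [hJa])
  -- Independence of `u` from `v` makes `x ↦ a + (x • u + γ x • v)` injective; this is where
  -- dimension at least two enters.
  obtain ⟨u, hu⟩ := exists_linearIndependent_pair_of_one_lt_finrank (R := ℂ) (by omega) hv0
  have hindep : ∀ s t : ℂ, s • v + t • u = 0 → s = 0 ∧ t = 0 := LinearIndependent.pair_iff.1 hu
  set V : Set (ℂ × ℂ) := (fun p : ℂ × ℂ => a + (p.1 • u + p.2 • v)) ⁻¹' U with hVdef
  have hVo : IsOpen V := hU.preimage (by fun_prop)
  have hgd : DifferentiableOn ℂ (fun p : ℂ × ℂ => J (a + (p.1 • u + p.2 • v))) V :=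
    hJd.comp (by fun_prop) fun p hp => hp
  obtain ⟨x₀, γ, hγ⟩ := exists_graph_subset_zeros hVo hgd (p := (0, 0)) (by simpa [hVdef] using ha)
    (by simpa using hJa) (by simpa using hv)
  obtain ⟨δ, hδ, hball⟩ := Metric.eventually_nhds_iff_ball.1 hγ
  set φ : ℂ → F := fun x => f (a + (x • u + γ x • v)) with hφ
  have hφd : ∀ x ∈ ball x₀ δ, HasDerivAt φ 0 x := by
    intro x hx
    obtain ⟨h1, h2, h3⟩ := hball x hx
    have hin : HasDerivAt (fun x => a + (x • u + γ x • v)) ((1 : ℂ) • u + deriv γ x • v) x :=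
      (((hasDerivAt_id x).smul_const u).add (h1.hasDerivAt.smul_const v)).const_add a
    have hfd := (hf.differentiableAt (hU.mem_nhds h2)).hasFDerivAt
    have := hfd.comp_hasDerivAt x hin
    rwa [hJzero _ h2 h3, _root_.zero_apply] at this
  have hmem : x₀ + (δ / 2 : ℝ) ∈ ball x₀ δ := by
    rw [mem_ball, dist_eq_norm, add_sub_cancel_left, Complex.norm_real,
      Real.norm_of_nonneg (by positivity)]
    linarith
  have hc : φ (x₀ + (δ / 2 : ℝ)) = φ x₀ :=
    isOpen_ball.is_const_of_deriv_eq_zero (convex_ball x₀ δ).isPreconnected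
      (fun x hx => (hφd x hx).differentiableAt.differentiableWithinAt)
      (fun x hx => (hφd x hx).deriv) hmem (mem_ball_self hδ)
  have heq := add_left_cancel (hinj (hball _ hmem).2.1 (hball _ (mem_ball_self hδ)).2.1 hc)
  have hz := hindep (γ (x₀ + (δ / 2 : ℝ)) - γ x₀) ((δ / 2 : ℝ) : ℂ) (by
    rw [← sub_eq_zero.2 heq]
    module)
  have := Complex.ofReal_eq_zero.1 hz.2
  linarith

theorem fderiv_ne_zero_of_injOn_of_finrank_eq_one (hE : Module.finrank ℂ E = 1)
    (hF : Module.finrank ℂ F = 1) {f : E → F} {U : Set E}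
    (hU : IsOpen U) (hf : DifferentiableOn ℂ f U) (hinj : InjOn f U) {a : E} (ha : a ∈ U) :
    fderiv ℂ f a ≠ 0 := by
  intro hfa
  set L : F ≃L[ℂ] ℂ := ContinuousLinearEquiv.ofFinrankEq (by rw [hF, Module.finrank_self])
  set L' : ℂ ≃L[ℂ] E := ContinuousLinearEquiv.ofFinrankEq (by rw [hE, Module.finrank_self])
  have hd : DifferentiableOn ℂ (fun x => L (f (L' x))) (L' ⁻¹' U) :=
    L.differentiable.comp_differentiableOn
      (hf.comp L'.differentiable.differentiableOn fun x hx => hx)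
  refine deriv_ne_zero_of_injOn (hU.preimage L'.continuous) hd ?_ (a := L'.symm a) (by simpa) ?_
  · intro x hx y hy hxy
    exact L'.injective (hinj hx hy (L.injective hxy))
  · have h1 : HasFDerivAt f (fderiv ℂ f a) (L' (L'.symm a)) := by
      rw [L'.apply_symm_apply]
      exact (hf.differentiableAt (hU.mem_nhds ha)).hasFDerivAt
    have h2 := (L : F →L[ℂ] ℂ).hasFDerivAt.comp_hasDerivAt _
      (h1.comp_hasDerivAt _ (L' : ℂ →L[ℂ] E).hasDerivAt)
    rw [hfa] at h2
    exact h2.deriv.trans (by simp)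

theorem injectiveDifferentials (n : ℕ) : InjectiveDifferentials.{u} n := by
  induction n with
  | zero =>
    intro E F _ _ _ _ _ _ hE _ f U _ _ _ a _ x y _
    have : Subsingleton E := Module.finrank_zero_iff.1 hE
    exact Subsingleton.elim x y
  | succ n ih =>
    intro E F _ _ _ _ _ _ hE hF f U hU hf hinj a ha
    have hrank : ∀ z ∈ U, fderiv ℂ f z ≠ 0 → Function.Injective (fderiv ℂ f z) := fun z hz =>
      injective_fderiv_of_fderiv_ne_zero ih hE hF hU hf hinj hz
    refine hrank a ha ?_
    rcases Nat.eq_zero_or_pos n with rfl | hn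
    · exact fderiv_ne_zero_of_injOn_of_finrank_eq_one hE hF hU hf hinj ha
    · exact fderiv_ne_zero_of_injOn_of_two_le (by omega) (by omega) hU hf hinj hrank ha

/-- **Osgood's theorem**: an injective holomorphic map between spaces of the same finite dimension
has injective differential at every point. -/
theorem injective_fderiv_of_injOn (hEF : Module.finrank ℂ E = Module.finrank ℂ F) {f : E → F}
    {U : Set E} (hU : IsOpen U) (hf : DifferentiableOn ℂ f U) (hinj : InjOn f U) {a : E}
    (ha : a ∈ U) : Function.Injective (fderiv ℂ f a) :=
  injectiveDifferentials _ E F rfl hEF.symm f U hU hf hinj a ha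

end Osgood

/-! ### Holomorphic lifting through an injective map -/

section HolomorphicLift

universe u

variable {E F : Type u} [NormedAddCommGroup E] [NormedSpace ℂ E] [FiniteDimensional ℂ E]
  [NormedAddCommGroup F] [NormedSpace ℂ F] [FiniteDimensional ℂ F]
  {G : Type*} [NormedAddCommGroup G] [NormedSpace ℂ G]

/-- A holomorphic map with values in the image of an injective holomorphic map lifts
holomorphically. -/
theorem exists_holomorphic_lift (hEF : Module.finrank ℂ E = Module.finrank ℂ F) {f : G → F}
    {g : E → F} {U : Set E} {V : Set G} (hU : IsOpen U) (hV : IsOpen V)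
    (hf : DifferentiableOn ℂ f V) (hg : DifferentiableOn ℂ g U) (hinj : InjOn g U)
    (hsub : f '' V ⊆ g '' U) :
    ∃ v : G → E, DifferentiableOn ℂ v V ∧ MapsTo v V U ∧ ∀ z ∈ V, g (v z) = f z := by
  have hex : ∀ z ∈ V, ∃ w ∈ U, g w = f z := fun z hz => hsub (mem_image_of_mem f hz)
  choose! v hvU hgv using hex
  refine ⟨v, fun z hz => DifferentiableAt.differentiableWithinAt ?_, hvU, hgv⟩
  have hi := injective_fderiv_of_injOn hEF hU hg hinj (hvU z hz)
  set e : E ≃L[ℂ] F :=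
    (LinearEquiv.ofInjectiveOfFinrankEq (fderiv ℂ g (v z) : E →ₗ[ℂ] F) hi hEF).toContinuousLinearEquiv
    with he
  have hge : HasFDerivAt g (e : E →L[ℂ] F) (v z) := by
    have : (e : E →L[ℂ] F) = fderiv ℂ g (v z) := by ext x; rfl
    rw [this]
    exact (hg.differentiableAt (hU.mem_nhds (hvU z hz))).hasFDerivAt
  have hgc : ContDiffAt ℂ (1 : ℕ) g (v z) :=
    (hg.contDiffOn_nat hU 1).contDiffAt (hU.mem_nhds (hvU z hz))
  have hone : ((1 : ℕ) : WithTop ℕ∞) ≠ 0 := by simp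
  set φ := hgc.localInverse hge hone with hφ
  have hstrict : HasStrictFDerivAt g (e : E →L[ℂ] F) (v z) := hgc.hasStrictFDerivAt' hge hone
  have hφc : ContDiffAt ℂ (1 : ℕ) φ (f z) := by
    rw [← hgv z hz]
    exact hgc.to_localInverse hge hone
  have hφz : φ (f z) = v z := by
    rw [← hgv z hz]
    exact hgc.localInverse_apply_image hge hone
  have hright : ∀ᶠ y in 𝓝 (f z), g (φ y) = y := by
    rw [← hgv z hz]
    exact hstrict.eventually_right_inverse
  have hfz : DifferentiableAt ℂ f z := hf.differentiableAt (hV.mem_nhds hz)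
  have hφU : ∀ᶠ y in 𝓝 (f z), φ y ∈ U :=
    hφc.continuousAt.eventually (hU.eventually_mem (by rw [hφz]; exact hvU z hz))
  -- The lift `v` was chosen pointwise, with no continuity known; injectivity of `g` on `U` forces
  -- it to agree with the local inverse.
  have hev : v =ᶠ[𝓝 z] φ ∘ f := by
    filter_upwards [hfz.continuousAt.eventually hright, hfz.continuousAt.eventually hφU,
      hV.eventually_mem hz] with y hy1 hy2 hyV
    exact hinj (hvU y hyV) hy2 ((hgv y hyV).trans hy1.symm)
  exact ((hφc.differentiableAt hone).comp z hfz).congr_of_eventuallyEq hev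

end HolomorphicLift

/-! ### Schwarz–Pick growth estimates -/

section SchwarzPick

/-- The growth consequence of the Schwarz–Pick lemma. -/
theorem norm_le_of_mapsTo_closedBall {p : ℂ → ℂ} (hd : DifferentiableOn ℂ p (ball 0 1))
    (hp : ∀ ζ ∈ ball (0 : ℂ) 1, ‖p ζ‖ ≤ 1) {a : ℝ} (ha : a < 1) (hp0 : ‖p 0‖ ≤ a) {ζ : ℂ}
    (hζ : ζ ∈ ball (0 : ℂ) 1) : ‖p ζ‖ ≤ (a + ‖ζ‖) / (1 + a * ‖ζ‖) := by
  have ha0 : 0 ≤ a := (norm_nonneg _).trans hp0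
  set b := ‖p 0‖ with hb
  have hb0 : 0 ≤ b := norm_nonneg _
  have hden : ∀ ζ ∈ ball (0 : ℂ) 1, 1 - (starRingEnd ℂ) (p 0) * p ζ ≠ 0 := by
    intro ζ hζ h
    have h1 : (starRingEnd ℂ) (p 0) * p ζ = 1 := (sub_eq_zero.1 h).symm
    have h2 : ‖(starRingEnd ℂ) (p 0) * p ζ‖ = b * ‖p ζ‖ := by rw [norm_mul, RCLike.norm_conj]
    rw [h1, norm_one] at h2
    nlinarith [hp ζ hζ, norm_nonneg (p ζ)]
  have hid : ∀ w : ℂ, ‖1 - (starRingEnd ℂ) (p 0) * w‖ ^ 2 =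
      ‖w - p 0‖ ^ 2 + (1 - b ^ 2) * (1 - ‖w‖ ^ 2) := by
    intro w
    rw [hb]
    simp only [← Complex.normSq_eq_norm_sq, Complex.normSq_apply]
    simp
    ring
  set m : ℂ → ℂ := fun ζ => (p ζ - p 0) / (1 - (starRingEnd ℂ) (p 0) * p ζ) with hm
  have hmd : DifferentiableOn ℂ m (ball 0 1) :=
    (hd.sub_const _).div ((differentiableOn_const 1).sub (hd.const_mul _)) hden
  -- `m` is `p` followed by the disc automorphism taking `p 0` to `0`, so the Schwarz lemma applies
  -- to it.
  have hm1 : MapsTo m (ball 0 1) (closedBall 0 1) := by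
    intro ζ hζ
    rw [mem_closedBall_zero_iff, hm, norm_div, div_le_one (norm_pos_iff.2 (hden ζ hζ))]
    rw [← pow_le_pow_iff_left₀ (norm_nonneg _) (norm_nonneg _) two_ne_zero, hid]
    have h1 : 0 ≤ 1 - b ^ 2 := by nlinarith
    have h2 : 0 ≤ 1 - ‖p ζ‖ ^ 2 := by nlinarith [hp ζ hζ, norm_nonneg (p ζ)]
    nlinarith [mul_nonneg h1 h2]
  have hmz := Complex.norm_le_norm_of_mapsTo_ball hmd hm1 (by simp [hm])
    (mem_ball_zero_iff.1 hζ)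
  rw [hm, norm_div, div_le_iff₀ (norm_pos_iff.2 (hden ζ hζ))] at hmz
  set r := ‖ζ‖ with hr
  set x := ‖p ζ‖ with hx
  have hr0 : 0 ≤ r := norm_nonneg _
  have hr1 : r < 1 := mem_ball_zero_iff.1 hζ
  have hx1 : x ≤ 1 := hp ζ hζ
  have hx0 : 0 ≤ x := norm_nonneg _
  -- The bound increases with the value at `0`, so it suffices to treat `b = ‖p 0‖`.
  have hab : (b + r) / (1 + b * r) ≤ (a + r) / (1 + a * r) := by
    rw [div_le_div_iff₀ (by positivity) (by positivity)]
    nlinarith [mul_nonneg (sub_nonneg.2 hp0) (by nlinarith : 0 ≤ 1 - r ^ 2)]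
  refine le_trans ?_ hab
  rw [le_div_iff₀ (by positivity)]
  have hsq : ‖p ζ - p 0‖ ^ 2 ≤ r ^ 2 * (‖p ζ - p 0‖ ^ 2 + (1 - b ^ 2) * (1 - x ^ 2)) := by
    rw [← hid, ← mul_pow]
    exact pow_le_pow_left₀ (norm_nonneg _) hmz 2
  have hxb : x - b ≤ ‖p ζ - p 0‖ := norm_sub_norm_le _ _
  by_cases hle : x ≤ b
  · nlinarith [mul_nonneg hr0 hb0]
  · push Not at hle
    have hs : (x - b) ^ 2 ≤ ‖p ζ - p 0‖ ^ 2 := pow_le_pow_left₀ (by linarith) hxb 2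
    have hr2 : 0 ≤ 1 - r ^ 2 := by nlinarith
    have h1 : (x - b) ^ 2 ≤ (r * (1 - b * x)) ^ 2 := by
      nlinarith [mul_le_mul_of_nonneg_left hs hr2]
    have hbx : 0 ≤ 1 - b * x := by nlinarith
    have h2 := abs_le_of_sq_le_sq h1 (mul_nonneg hr0 hbx)
    nlinarith [le_abs_self (x - b)]

variable {E : Type*} [NormedAddCommGroup E] [NormedSpace ℂ E]

/-- With `u = z / ‖z‖` and a functional `w` norming `v z`, the quotient `w (v (ζ • u)) / ζ` is
bounded by `1` on the disc and by `a` at `0`; the scalar estimate applies to it. -/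
theorem norm_le_of_fderiv_eq_smul_id {v : E → E} (hd : DifferentiableOn ℂ v (ball 0 1))
    (hv : MapsTo v (ball 0 1) (ball 0 1)) (hv0 : v 0 = 0) {a : ℝ} (ha0 : 0 ≤ a) (ha : a < 1)
    (hfd : HasFDerivAt v ((a : ℂ) • ContinuousLinearMap.id ℂ E) 0) {z : E} (hz : ‖z‖ < 1) :
    ‖v z‖ ≤ ‖z‖ * ((a + ‖z‖) / (1 + a * ‖z‖)) := by
  rcases eq_or_ne z 0 with rfl | hz0
  · simp [hv0]
  have hzn : 0 < ‖z‖ := norm_pos_iff.2 hz0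
  set u : E := ((‖z‖⁻¹ : ℝ) : ℂ) • z with hu
  have hun : ‖u‖ = 1 := by
    rw [hu, norm_smul, Complex.norm_real, norm_inv, norm_norm, inv_mul_cancel₀ hzn.ne']
  have hzu : ((‖z‖ : ℝ) : ℂ) • u = z := by
    rw [hu, smul_smul, ← Complex.ofReal_mul, mul_inv_cancel₀ hzn.ne', Complex.ofReal_one, one_smul]
  obtain ⟨w, hw1, hwv⟩ := exists_dual_vector'' ℂ (v z)
  set h : ℂ → ℂ := fun ζ => w (v (ζ • u)) with hh
  have hline : MapsTo (fun ζ : ℂ => ζ • u) (ball 0 1) (ball 0 1) := by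
    intro ζ hζ
    simpa [norm_smul, hun] using hζ
  have hhd : DifferentiableOn ℂ h (ball 0 1) :=
    w.differentiable.comp_differentiableOn (hd.comp (by fun_prop) hline)
  have hh0 : h 0 = 0 := by simp [hh, hv0]
  have hhmaps : MapsTo h (ball 0 1) (closedBall (h 0) 1) := by
    intro ζ hζ
    rw [hh0, mem_closedBall_zero_iff]
    have h1 : ‖v (ζ • u)‖ < 1 := mem_ball_zero_iff.1 (hv (hline hζ))
    calc ‖w (v (ζ • u))‖ ≤ ‖w‖ * ‖v (ζ • u)‖ := w.le_opNorm _
      _ ≤ 1 * 1 := by gcongr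
      _ = 1 := one_mul 1
  have hpd : DifferentiableOn ℂ (dslope h 0) (ball 0 1) :=
    (Complex.differentiableOn_dslope (ball_mem_nhds _ one_pos)).2 hhd
  have hder : HasDerivAt h (w ((a : ℂ) • u)) 0 := by
    have h1 : HasDerivAt (fun ζ : ℂ => ζ • u) ((1 : ℂ) • u) 0 := (hasDerivAt_id 0).smul_const u
    have h2 : HasFDerivAt v ((a : ℂ) • ContinuousLinearMap.id ℂ E) ((0 : ℂ) • u) := by
      rwa [zero_smul]
    have h3 := w.hasFDerivAt.comp_hasDerivAt (0 : ℂ) (h2.comp_hasDerivAt (0 : ℂ) h1)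
    have h4 : ((a : ℂ) • ContinuousLinearMap.id ℂ E) ((1 : ℂ) • u) = (a : ℂ) • u := by simp
    rw [h4] at h3
    exact h3
  have hp0 : ‖dslope h 0 0‖ ≤ a := by
    rw [dslope_same, hder.deriv]
    calc ‖w ((a : ℂ) • u)‖ ≤ ‖w‖ * ‖(a : ℂ) • u‖ := w.le_opNorm _
      _ ≤ 1 * a := by
        rw [norm_smul, hun, mul_one, Complex.norm_real, Real.norm_of_nonneg ha0]
        gcongr
      _ = a := one_mul a
  have hmem : ((‖z‖ : ℝ) : ℂ) ∈ ball (0 : ℂ) 1 := by simpa using hz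
  have key := norm_le_of_mapsTo_closedBall hpd
    (fun ζ hζ => by simpa using Complex.norm_dslope_le_div_of_mapsTo_ball hhd hhmaps hζ) ha hp0 hmem
  have hne : ((‖z‖ : ℝ) : ℂ) ≠ 0 := by exact_mod_cast hzn.ne'
  rw [dslope_of_ne _ hne, slope_def_field, hh0, sub_zero, sub_zero, norm_div] at key
  simp only [hh, hzu, hwv] at key
  simp only [Complex.norm_real, norm_norm, RCLike.norm_ofReal, abs_norm] at key
  rwa [div_le_iff₀ hzn, mul_comm] at key

end SchwarzPick

/-! ### The Koebe function -/

section KoebeFunction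

/-- The Koebe function `x / (1 - x)²`. -/
noncomputable def koebe (x : ℝ) : ℝ := x / (1 - x) ^ 2

theorem koebe_nonneg {x : ℝ} (hx : 0 ≤ x) : 0 ≤ koebe x := by
  unfold koebe
  positivity

theorem koebe_mono {x y : ℝ} (hx : 0 ≤ x) (hxy : x ≤ y) (hy : y < 1) : koebe x ≤ koebe y := by
  unfold koebe
  have : 0 < 1 - y := by linarith
  have : 0 ≤ y := hx.trans hxy
  gcongr

theorem le_koebe {x : ℝ} (hx : 0 ≤ x) (hx1 : x < 1) : x ≤ koebe x := by
  unfold koebe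
  rw [le_div_iff₀ (by nlinarith)]
  nlinarith [mul_nonneg hx hx, mul_nonneg hx (by linarith : 0 ≤ 2 - x)]

/-- The ratio of the Koebe values is `(a + r) * (1 + a * r) / (1 + r) ^ 2`. The two factors of the
numerator sum to `(1 + a) * (1 + r)`, so AM–GM gives a bound independent of `r`, which can be
iterated. -/
theorem koebe_schwarzPick_le {a r : ℝ} (ha0 : 0 ≤ a) (hr0 : 0 ≤ r) (hr : r < 1) :
    koebe (r * ((a + r) / (1 + a * r))) ≤ ((1 + a) / 2) ^ 2 * koebe r := by
  have h1 : 0 < 1 + a * r := by positivity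
  have h2 : 0 < 1 - r := by linarith
  have h3 : 0 < 1 + r := by linarith
  have hx : 1 - r * ((a + r) / (1 + a * r)) = (1 - r) * (1 + r) / (1 + a * r) := by
    field_simp
    ring
  have hK : koebe (r * ((a + r) / (1 + a * r))) =
      ((a + r) * (1 + a * r) / (1 + r) ^ 2) * koebe r := by
    unfold koebe
    rw [hx]
    field_simp
  rw [hK]
  gcongr
  · exact koebe_nonneg hr0
  · rw [div_le_iff₀ (by positivity)]
    nlinarith [sq_nonneg ((a + r) - (1 + a * r))]

end KoebeFunction

/-! ### Growth along Loewner chains -/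

section LoewnerChains

variable {n : ℕ} {F : ℝ≥0 → Cn n → Cn n}

theorem IsLoewnerChain.eq_exp_smul (F : ℝ≥0 → Cn n → Cn n) (t : ℝ≥0) :
    F t = fun z => (Real.exp t : ℂ) • rescaled F t z := by
  funext z
  rw [rescaled, ← Complex.coe_smul, smul_smul, ← Complex.ofReal_mul, ← Real.exp_add,
    add_neg_cancel, Real.exp_zero, Complex.ofReal_one, one_smul]

theorem IsLoewnerChain.differentiableOn (h : IsLoewnerChain F) (t : ℝ≥0) :
    DifferentiableOn ℂ (F t) (unitBall n) := by
  rw [eq_exp_smul F t]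
  exact (h.normalized t).holomorphic.const_smul (Real.exp t : ℂ)

theorem IsLoewnerChain.injOn (h : IsLoewnerChain F) (t : ℝ≥0) : InjOn (F t) (unitBall n) := by
  intro x hx y hy hxy
  refine (h.normalized t).univalent hx hy ?_
  simp only [rescaled, hxy]

theorem IsLoewnerChain.map_zero (h : IsLoewnerChain F) (t : ℝ≥0) : F t 0 = 0 := by
  rw [eq_exp_smul F t]
  simp only [(h.normalized t).map_zero, smul_zero]

theorem IsNormalizedUnivalent.hasFDerivAt_zero {f : Cn n → Cn n} (hf : IsNormalizedUnivalent f) :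
    HasFDerivAt f (ContinuousLinearMap.id ℂ (Cn n)) 0 := by
  rw [← hf.fderiv_zero]
  exact (hf.holomorphic.differentiableAt (ball_mem_nhds _ one_pos)).hasFDerivAt

theorem IsLoewnerChain.hasFDerivAt_zero (h : IsLoewnerChain F) (t : ℝ≥0) :
    HasFDerivAt (F t) ((Real.exp t : ℂ) • ContinuousLinearMap.id ℂ (Cn n)) 0 := by
  rw [eq_exp_smul F t]
  exact (h.normalized t).hasFDerivAt_zero.const_smul (Real.exp t : ℂ)

/-- One step of the growth estimate along a Loewner chain. -/
theorem IsLoewnerChain.koebe_norm_le (h : IsLoewnerChain F) {s t : ℝ≥0} (hst : s < t)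
    {x y : Cn n} (hx : x ∈ unitBall n) (hy : y ∈ unitBall n) (hxy : F t y = F s x) :
    koebe ‖y‖ ≤ ((1 + Real.exp (-((t : ℝ) - s))) / 2) ^ 2 * koebe ‖x‖ := by
  obtain ⟨v, hvd, hvm, hv⟩ := exists_holomorphic_lift rfl isOpen_ball isOpen_ball
    (h.differentiableOn s) (h.differentiableOn t) (h.injOn t) (h.image_subset s t hst.le)
  have h0mem : (0 : Cn n) ∈ unitBall n := mem_ball_self one_pos
  have hv0 : v 0 = 0 := by
    refine h.injOn t (hvm h0mem) h0mem ?_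
    rw [hv 0 h0mem, h.map_zero, h.map_zero]
  have hyv : y = v x := h.injOn t hy (hvm hx) (hxy.trans (hv x hx).symm)
  set a := Real.exp (-((t : ℝ) - s)) with ha
  have ha0 : 0 < a := Real.exp_pos _
  have ha1 : a < 1 := by
    rw [ha, Real.exp_lt_one_iff]
    have : (s : ℝ) < t := hst
    linarith
  have hvat : DifferentiableAt ℂ v 0 := hvd.differentiableAt (ball_mem_nhds _ one_pos)
  have hfd : HasFDerivAt v ((a : ℂ) • ContinuousLinearMap.id ℂ (Cn n)) 0 := by
    have h1 : HasFDerivAt (F t ∘ v)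
        (((Real.exp t : ℂ) • ContinuousLinearMap.id ℂ (Cn n)) ∘L fderiv ℂ v 0) 0 :=
      HasFDerivAt.comp 0 (by rw [hv0]; exact h.hasFDerivAt_zero t) hvat.hasFDerivAt
    have h2 : HasFDerivAt (F t ∘ v) ((Real.exp s : ℂ) • ContinuousLinearMap.id ℂ (Cn n)) 0 := by
      refine (h.hasFDerivAt_zero s).congr_of_eventuallyEq ?_
      filter_upwards [ball_mem_nhds (0 : Cn n) one_pos] with z hz
      exact hv z hz
    have h3 := h1.unique h2
    have hexp : (Real.exp s : ℂ) = (Real.exp t : ℂ) * (a : ℂ) := by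
      rw [← Complex.ofReal_mul, ha, ← Real.exp_add]
      congr 2
      ring
    have hne : (Real.exp t : ℂ) ≠ 0 := by exact_mod_cast (Real.exp_pos _).ne'
    have h4 : fderiv ℂ v 0 = (a : ℂ) • ContinuousLinearMap.id ℂ (Cn n) := by
      rw [ContinuousLinearMap.smul_comp, ContinuousLinearMap.id_comp, hexp, mul_smul] at h3
      exact smul_right_injective _ hne h3
    rw [← h4]
    exact hvat.hasFDerivAt
  have hxn : ‖x‖ < 1 := mem_ball_zero_iff.1 hx
  have key := norm_le_of_fderiv_eq_smul_id hvd hvm hv0 ha0.le ha1 hfd hxn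
  rw [hyv]
  refine (koebe_mono (norm_nonneg _) key ?_).trans
    (koebe_schwarzPick_le ha0.le (norm_nonneg _) hxn)
  have h1 : 0 ≤ ‖x‖ := norm_nonneg _
  rw [← mul_div_assoc, div_lt_one (by positivity)]
  nlinarith

/-- The left side equals `e^(-τ/2) * cosh (τ/2)`, and `cosh x ≤ e^(x²/2)`. The quadratic error
disappears when the step is refined. -/
theorem half_one_add_exp_neg_le (τ : ℝ) :
    (1 + Real.exp (-τ)) / 2 ≤ Real.exp (-τ / 2 + τ ^ 2 / 8) := by
  have h1 : (1 + Real.exp (-τ)) / 2 = Real.exp (-τ / 2) * Real.cosh (τ / 2) := by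
    rw [Real.cosh_eq, mul_div_assoc', mul_add, ← Real.exp_add, ← Real.exp_add]
    congr 2
    · rw [show -τ / 2 + τ / 2 = 0 by ring, Real.exp_zero]
    · congr 1
      ring
  rw [h1, Real.exp_add]
  gcongr
  refine (Real.cosh_le_exp_half_sq _).trans_eq ?_
  congr 1
  ring

/-- Iterating the one-step bound over `N + 1` steps of length `τ = t / (N + 1)` gives the factor
`e^((N + 1)(-τ + τ²/4)) = e^(-t + t²/(4(N + 1)))`; then `N → ∞`. -/
theorem IsLoewnerChain.koebe_norm_le_exp_neg (h : IsLoewnerChain F) (t : ℝ≥0) {x y : Cn n}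
    (hx : x ∈ unitBall n) (hy : y ∈ unitBall n) (hxy : F t y = F 0 x) :
    koebe ‖y‖ ≤ Real.exp (-t) * koebe ‖x‖ := by
  rcases eq_or_ne t 0 with rfl | ht
  · simp [h.injOn 0 hy hx hxy]
  have hex : ∀ s, ∃ w ∈ unitBall n, F s w = F 0 x := fun s =>
    h.image_subset 0 s (zero_le) (mem_image_of_mem _ hx)
  choose w hw hFw using hex
  have hbound : ∀ N : ℕ, koebe ‖y‖ ≤
      Real.exp (-t + (t : ℝ) ^ 2 / 4 * (1 / ((N : ℝ) + 1))) * koebe ‖x‖ := by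
    intro N
    set τ : ℝ≥0 := t / (N + 1) with hτ
    have hτ0 : 0 < τ := by positivity
    set q : ℝ := ((1 + Real.exp (-τ)) / 2) ^ 2 with hq
    have hq0 : 0 ≤ q := by positivity
    have hstep : ∀ k : ℕ, koebe ‖w (k * τ)‖ ≤ q ^ k * koebe ‖x‖ := by
      intro k
      induction k with
      | zero =>
        have : w 0 = x := h.injOn 0 (hw 0) hx (hFw 0)
        simp [this]
      | succ k ih =>
        have hlt : (k : ℝ≥0) * τ < ((k + 1 : ℕ) : ℝ≥0) * τ := by
          push_cast
          rw [add_mul, one_mul]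
          exact lt_add_of_pos_right _ hτ0
        have h1 := h.koebe_norm_le hlt (hw _) (hw _) ((hFw _).trans (hFw _).symm)
        have h2 : (((k + 1 : ℕ) : ℝ≥0) * τ : ℝ≥0) - ((k : ℝ≥0) * τ : ℝ≥0) = (τ : ℝ) := by
          push_cast
          ring
        rw [h2] at h1
        calc _ ≤ q * koebe ‖w (k * τ)‖ := h1
          _ ≤ q * (q ^ k * koebe ‖x‖) := by gcongr
          _ = _ := by ring
    have hNτ : ((N + 1 : ℕ) : ℝ≥0) * τ = t := by
      rw [hτ]
      push_cast
      field_simp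
    have hN := hstep (N + 1)
    rw [hNτ, h.injOn t (hw t) hy ((hFw t).trans hxy.symm)] at hN
    refine hN.trans ?_
    gcongr
    · exact koebe_nonneg (norm_nonneg _)
    · have hτt : (τ : ℝ) = t / (N + 1) := by rw [hτ]; push_cast; ring
      calc q ^ (N + 1) ≤ (Real.exp (-(τ : ℝ) / 2 + (τ : ℝ) ^ 2 / 8) ^ 2) ^ (N + 1) := by
            rw [hq]
            gcongr
            exact half_one_add_exp_neg_le _
        _ = _ := by
          rw [← Real.exp_nat_mul, ← Real.exp_nat_mul, hτt]
          congr 1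
          push_cast
          field_simp
          ring
  have hlim : Tendsto (fun N : ℕ =>
      Real.exp (-t + (t : ℝ) ^ 2 / 4 * (1 / ((N : ℝ) + 1))) * koebe ‖x‖) atTop
      (𝓝 (Real.exp (-t) * koebe ‖x‖)) := by
    have h1 := (tendsto_one_div_add_atTop_nhds_zero_nat (𝕜 := ℝ)).const_mul ((t : ℝ) ^ 2 / 4)
    have h2 := (h1.const_add (-(t : ℝ))).rexp.mul_const (koebe ‖x‖)
    simpa using h2
  exact ge_of_tendsto' hlim hbound

/-- Otherwise some sequence has `‖u k (z k)‖ > k` with `z k ∈ K`; a subsequence is uniformly close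
on `K` to a continuous, hence bounded, limit. -/
theorem IsNormalFamily.exists_bound {𝓕 : Set (Cn n → Cn n)} {U K : Set (Cn n)}
    (h : IsNormalFamily 𝓕 U) (hU : IsOpen U) (hc : ∀ g ∈ 𝓕, ContinuousOn g U) (hK : IsCompact K)
    (hKU : K ⊆ U) : ∃ M : ℝ, ∀ g ∈ 𝓕, ∀ z ∈ K, ‖g z‖ ≤ M := by
  by_contra! hcon
  choose u hu z hz hlt using fun k : ℕ => hcon k
  obtain ⟨φ, g, hφ, hlim⟩ := h u hu
  have hgc : ContinuousOn g U :=
    hlim.continuousOn (Frequently.of_forall fun k => hc _ (hu (φ k)))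
  obtain ⟨C, hC⟩ := hK.exists_bound_of_continuousOn (hgc.mono hKU)
  have hunif := (tendstoLocallyUniformlyOn_iff_forall_isCompact hU).1 hlim K hKU hK
  rw [Metric.tendstoUniformlyOn_iff] at hunif
  obtain ⟨N, hN⟩ := exists_nat_gt (C + 1)
  obtain ⟨k, hk, hkN⟩ := ((hunif 1 one_pos).and (eventually_ge_atTop N)).exists
  have h1 := hk (z (φ k)) (hz _)
  have h2 := hC (z (φ k)) (hz _)
  have h3 := hlt (φ k)
  have h4 : (N : ℝ) ≤ (φ k : ℝ) := by exact_mod_cast hkN.trans (hφ.id_le k)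
  rw [dist_eq_norm] at h1
  have h5 := norm_sub_norm_le (u (φ k) (z (φ k))) (g (z (φ k)))
  rw [norm_sub_rev] at h5
  linarith

/-- The upper growth estimate for a normal Loewner chain. -/
theorem IsNormalLoewnerChain.norm_le_koebe (h : IsNormalLoewnerChain F) {x : Cn n}
    (hx : x ∈ unitBall n) : ‖F 0 x‖ ≤ koebe ‖x‖ := by
  have hhalf : closedBall (0 : Cn n) (1 / 2) ⊆ unitBall n := closedBall_subset_ball (by norm_num)
  obtain ⟨M, hM⟩ := h.normal.exists_bound isOpen_ball (by
    rintro _ ⟨t, rfl⟩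
    exact (h.normalized t).holomorphic.continuousOn) (isCompact_closedBall 0 (1 / 2)) hhalf
  have hM' : ∀ t, ∀ z ∈ ball (0 : Cn n) (1 / 2), ‖rescaled F t z‖ ≤ M := fun t z hz =>
    hM _ (mem_range_self t) z (ball_subset_closedBall hz)
  have hM0 : 0 ≤ M := (norm_nonneg _).trans (hM' 0 0 (mem_ball_self (by norm_num)))
  set κ := koebe ‖x‖ with hκ
  have hκ0 : 0 ≤ κ := koebe_nonneg (norm_nonneg _)
  have hlim0 : Tendsto (fun t : ℝ≥0 => Real.exp (-(t : ℝ))) atTop (𝓝 0) :=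
    Real.tendsto_exp_neg_atTop_nhds_zero.comp (NNReal.tendsto_coe_atTop.2 tendsto_id)
  -- With `F_t y = F_0 x` and `‖y‖ ≤ e^(-t) κ`, the second-order error is `4M (‖y‖ / (1/2))² ≤ 16 M
  -- κ² e^(-2t)`; undoing the rescaling multiplies it by `e^t`.
  have hlim : Tendsto (fun t : ℝ≥0 => κ + 16 * M * κ ^ 2 * Real.exp (-(t : ℝ))) atTop (𝓝 κ) := by
    simpa using (hlim0.const_mul (16 * M * κ ^ 2)).const_add κ
  have hsmall : ∀ᶠ t : ℝ≥0 in atTop, Real.exp (-(t : ℝ)) * κ < 1 / 2 := by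
    have h1 : Tendsto (fun t : ℝ≥0 => Real.exp (-(t : ℝ)) * κ) atTop (𝓝 0) := by
      simpa using hlim0.mul_const κ
    exact h1.eventually_lt_const (by norm_num)
  refine ge_of_tendsto hlim (hsmall.mono fun t ht => ?_)
  obtain ⟨y, hy, hyx⟩ := h.image_subset 0 t (zero_le) (mem_image_of_mem _ hx)
  have hyK := h.koebe_norm_le_exp_neg t hx hy hyx
  have hyn : ‖y‖ ≤ Real.exp (-t) * κ :=
    (le_koebe (norm_nonneg _) (mem_ball_zero_iff.1 hy)).trans hyK
  have hyhalf : y ∈ ball (0 : Cn n) (1 / 2) := mem_ball_zero_iff.2 (hyn.trans_lt ht)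
  have key := norm_sub_linear_le_of_forall_mem_ball (by norm_num : (0 : ℝ) < 1 / 2)
    ((h.normalized t).holomorphic.mono (ball_subset_closedBall.trans hhalf)) (hM' t) hyhalf
  rw [(h.normalized t).map_zero, (h.normalized t).fderiv_zero, sub_zero, sub_zero,
    ContinuousLinearMap.id_apply] at key
  have hre : ‖rescaled F t y‖ ≤ ‖y‖ + 16 * M * ‖y‖ ^ 2 := by
    have h1 := norm_sub_norm_le (rescaled F t y) y
    have h2 : 4 * M * (‖y‖ / (1 / 2)) ^ 2 = 16 * M * ‖y‖ ^ 2 := by ring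
    linarith
  have hFy : ‖F 0 x‖ = Real.exp t * ‖rescaled F t y‖ := by
    rw [← hyx]
    conv_lhs => rw [IsLoewnerChain.eq_exp_smul F t]
    rw [norm_smul, Complex.norm_real, Real.norm_of_nonneg (Real.exp_pos _).le]
  rw [hFy]
  have hee : Real.exp t * Real.exp (-t) = 1 := by
    rw [← Real.exp_add, add_neg_cancel, Real.exp_zero]
  calc Real.exp t * ‖rescaled F t y‖
      ≤ Real.exp t * (Real.exp (-t) * κ + 16 * M * (Real.exp (-t) * κ) ^ 2) := by
        gcongr
        refine hre.trans ?_
        gcongr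
    _ = (Real.exp t * Real.exp (-t)) * κ +
        16 * M * κ ^ 2 * ((Real.exp t * Real.exp (-t)) * Real.exp (-t)) := by ring
    _ = _ := by rw [hee, one_mul, one_mul]

/-- The upper growth theorem for the class `S⁰`. -/
theorem norm_le_koebe_of_mem_classS0 {f : Cn n → Cn n} (hf : f ∈ classS0 n) {x : Cn n}
    (hx : x ∈ unitBall n) : ‖f x‖ ≤ koebe ‖x‖ := by
  obtain ⟨-, F, hF, hFf⟩ := hf
  rw [← hFf hx]
  exact hF.norm_le_koebe hx

end LoewnerChains

/-! ### Schwarz–Pick bounds for differentials and the distortion theorem -/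

section Distortion

variable {F : Type*} [NormedAddCommGroup F] [NormedSpace ℂ F]

/-- Precomposing with a Möbius map `φ` from the unit disc to the disc of radius `ρ`, with `φ 0 = b`
and `φ' 0 = (ρ² - ‖b‖²) / ρ`, moves the estimate to the centre. There Cauchy's estimate on circles
of radius `s → 1` suffices, also for vector values. -/
theorem norm_deriv_mul_le_of_forall_mem_ball {h : ℂ → F} {ρ M : ℝ} {b : ℂ}
    (hd : DifferentiableOn ℂ h (ball 0 ρ)) (hM : ∀ ζ ∈ ball (0 : ℂ) ρ, ‖h ζ‖ ≤ M)
    (hb : ‖b‖ < ρ) : ‖deriv h b‖ * (ρ ^ 2 - ‖b‖ ^ 2) ≤ M * ρ := by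
  have hρ : 0 < ρ := (norm_nonneg _).trans_lt hb
  have hρc : (ρ : ℂ) ≠ 0 := by exact_mod_cast hρ.ne'
  -- the automorphism of the disc of radius `ρ`, normalized on the unit disc, sending `0` to `b`
  have hden : ∀ u ∈ ball (0 : ℂ) 1, (ρ : ℂ) + (starRingEnd ℂ) b * u ≠ 0 := by
    intro u hu h0
    have h1 : ‖(ρ : ℂ)‖ = ‖(starRingEnd ℂ) b * u‖ := by
      rw [eq_neg_of_add_eq_zero_left h0, norm_neg]
    rw [Complex.norm_real, Real.norm_of_nonneg hρ.le, norm_mul, RCLike.norm_conj] at h1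
    have hu1 : ‖u‖ < 1 := mem_ball_zero_iff.1 hu
    nlinarith [norm_nonneg b, norm_nonneg u]
  set φ : ℂ → ℂ := fun u => ρ * (ρ * u + b) / (ρ + (starRingEnd ℂ) b * u) with hφ
  have hφd : DifferentiableOn ℂ φ (ball 0 1) :=
    DifferentiableOn.div (by fun_prop) (by fun_prop) hden
  have hφm : MapsTo φ (ball 0 1) (ball 0 ρ) := by
    intro u hu
    have hu1 : ‖u‖ < 1 := mem_ball_zero_iff.1 hu
    rw [mem_ball_zero_iff, hφ, norm_div, div_lt_iff₀ (norm_pos_iff.2 (hden u hu)), norm_mul,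
      Complex.norm_real, Real.norm_of_nonneg hρ.le]
    refine mul_lt_mul_of_pos_left ?_ hρ
    rw [← pow_lt_pow_iff_left₀ (norm_nonneg _) (norm_nonneg _) two_ne_zero]
    have hid : ‖(ρ : ℂ) + (starRingEnd ℂ) b * u‖ ^ 2 =
        ‖(ρ : ℂ) * u + b‖ ^ 2 + (ρ ^ 2 - ‖b‖ ^ 2) * (1 - ‖u‖ ^ 2) := by
      simp only [← Complex.normSq_eq_norm_sq, Complex.normSq_apply]
      simp
      ring
    rw [hid]
    have h1 : 0 < ρ ^ 2 - ‖b‖ ^ 2 := by nlinarith [norm_nonneg b]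
    have h2 : 0 < 1 - ‖u‖ ^ 2 := by nlinarith [norm_nonneg u]
    nlinarith [mul_pos h1 h2]
  have hφ0 : φ 0 = b := by
    simp only [hφ, mul_zero, zero_add, add_zero]
    field_simp
  have hnum : HasDerivAt (fun u : ℂ => (ρ : ℂ) * (ρ * u + b)) (ρ * ρ) 0 := by
    simpa using (((hasDerivAt_id (0 : ℂ)).const_mul (ρ : ℂ)).add_const b).const_mul (ρ : ℂ)
  have hdenom : HasDerivAt (fun u : ℂ => (ρ : ℂ) + (starRingEnd ℂ) b * u) ((starRingEnd ℂ) b) 0 := by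
    simpa using ((hasDerivAt_id (0 : ℂ)).const_mul ((starRingEnd ℂ) b)).const_add (ρ : ℂ)
  have hφ' : HasDerivAt φ (((ρ ^ 2 - ‖b‖ ^ 2) / ρ : ℝ) : ℂ) 0 := by
    have h1 := hnum.div hdenom (hden 0 (mem_ball_self one_pos))
    refine h1.congr_deriv ?_
    have hbb : (starRingEnd ℂ) b * b = (‖b‖ : ℂ) ^ 2 := Complex.conj_mul' b
    push_cast
    simp only [mul_zero, zero_add, add_zero]
    rw [← hbb]
    field_simp
  have hHd : DifferentiableOn ℂ (h ∘ φ) (ball 0 1) := hd.comp hφd hφm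
  have hH' : HasDerivAt (h ∘ φ) ((((ρ ^ 2 - ‖b‖ ^ 2) / ρ : ℝ) : ℂ) • deriv h b) 0 := by
    refine HasDerivAt.scomp (0 : ℂ) ?_ hφ'
    rw [hφ0]
    exact (hd.differentiableAt (isOpen_ball.mem_nhds (mem_ball_zero_iff.2 hb))).hasDerivAt
  have hcauchy : ∀ s ∈ Ioo (0 : ℝ) 1, ‖deriv (h ∘ φ) 0‖ ≤ M / s := by
    intro s hs
    refine Complex.norm_deriv_le_of_forall_mem_sphere_norm_le hs.1
      ((hHd.mono (closedBall_subset_ball hs.2)).diffContOnCl_ball subset_rfl) fun u hu => ?_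
    exact hM _ (hφm (closedBall_subset_ball hs.2 (sphere_subset_closedBall hu)))
  have hle : ‖deriv (h ∘ φ) 0‖ ≤ M := by
    have hlim : Tendsto (fun s : ℝ => M / s) (𝓝[<] 1) (𝓝 (M / 1)) :=
      (ContinuousAt.div continuousAt_const continuousAt_id one_ne_zero).tendsto.mono_left
        nhdsWithin_le_nhds
    rw [div_one] at hlim
    exact ge_of_tendsto hlim (eventually_of_mem (Ioo_mem_nhdsLT one_pos) hcauchy)
  have hpos : 0 < ρ ^ 2 - ‖b‖ ^ 2 := by nlinarith [norm_nonneg b]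
  rw [hH'.deriv, norm_smul, Complex.norm_real, Real.norm_of_nonneg (by positivity),
    div_mul_eq_mul_div, div_le_iff₀ hρ] at hle
  linarith

variable {H : Type*} [NormedAddCommGroup H] [InnerProductSpace ℂ H]

/-- The **Schwarz–Pick** bound for the differential of a bounded holomorphic map on a ball. -/
theorem norm_fderiv_mul_le_of_forall_mem_ball {f : H → F} {R M : ℝ} {z : H}
    (hd : DifferentiableOn ℂ f (ball 0 R)) (hM : ∀ y ∈ ball (0 : H) R, ‖f y‖ ≤ M)
    (hz : ‖z‖ < R) : ‖fderiv ℂ f z‖ * (R ^ 2 - ‖z‖ ^ 2) ≤ M * R := by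
  have hR : 0 < R := (norm_nonneg _).trans_lt hz
  have hM0 : 0 ≤ M := (norm_nonneg _).trans (hM 0 (mem_ball_self hR))
  have hpos : 0 < R ^ 2 - ‖z‖ ^ 2 := by nlinarith [norm_nonneg z]
  rw [← le_div_iff₀ hpos]
  refine ContinuousLinearMap.opNorm_le_of_unit_norm (𝕜 := ℂ) (by positivity) fun v hv => ?_
  set b : ℂ := inner ℂ v z with hb
  -- Since `w ⊥ v`, the line through `z` in direction `v` meets the ball in a disc centred at `w` of
  -- radius `ρ`, `ρ² = R² - ‖w‖²`. Thus `ρ² - ‖b‖² = R² - ‖z‖²`, and only `ρ ≤ R` is lost.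
  set w : H := z - b • v with hw
  have hvw : inner ℂ v w = 0 := by
    rw [hw, inner_sub_right, inner_smul_right, inner_self_eq_norm_sq_to_K, hv]
    simp [hb]
  have hnorm : ∀ ζ : ℂ, ‖w + ζ • v‖ ^ 2 = ‖w‖ ^ 2 + ‖ζ‖ ^ 2 := by
    intro ζ
    have h0 : inner ℂ w (ζ • v) = 0 := by
      rw [inner_smul_right, inner_eq_zero_symm.1 hvw, mul_zero]
    have := norm_add_sq_eq_norm_sq_add_norm_sq_of_inner_eq_zero w (ζ • v) h0
    rw [norm_smul, hv, mul_one] at this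
    nlinarith
  have hzw : w + b • v = z := by rw [hw, sub_add_cancel]
  have hzn : ‖z‖ ^ 2 = ‖w‖ ^ 2 + ‖b‖ ^ 2 := by rw [← hnorm, hzw]
  set ρ := Real.sqrt (R ^ 2 - ‖w‖ ^ 2) with hρ
  have hρ2 : ρ ^ 2 = R ^ 2 - ‖w‖ ^ 2 := Real.sq_sqrt (by nlinarith [sq_nonneg ‖b‖])
  have hρ0 : 0 ≤ ρ := Real.sqrt_nonneg _
  have hbρ : ‖b‖ < ρ := lt_of_pow_lt_pow_left₀ 2 hρ0 (by linarith)
  have hρR : ρ ≤ R := le_of_sq_le_sq (by nlinarith [sq_nonneg ‖w‖]) hR.le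
  have hline : MapsTo (fun ζ : ℂ => w + ζ • v) (ball 0 ρ) (ball 0 R) := by
    intro ζ hζ
    have hζ' : ‖ζ‖ < ρ := mem_ball_zero_iff.1 hζ
    rw [mem_ball_zero_iff]
    refine lt_of_pow_lt_pow_left₀ 2 hR.le ?_
    rw [hnorm]
    nlinarith [norm_nonneg ζ]
  have key := norm_deriv_mul_le_of_forall_mem_ball
    (hd.comp (by fun_prop : DifferentiableOn ℂ (fun ζ : ℂ => w + ζ • v) (ball 0 ρ)) hline)
    (fun ζ hζ => hM _ (hline hζ)) hbρ
  have hder : HasDerivAt (f ∘ fun ζ : ℂ => w + ζ • v) (fderiv ℂ f z v) b := by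
    have h1 : HasDerivAt (fun ζ : ℂ => w + ζ • v) v b := by
      simpa using ((hasDerivAt_id b).smul_const v).const_add w
    refine HasFDerivAt.comp_hasDerivAt b ?_ h1
    rw [hzw]
    exact (hd.differentiableAt (isOpen_ball.mem_nhds (mem_ball_zero_iff.2 hz))).hasFDerivAt
  rw [hder.deriv, hρ2] at key
  rw [le_div_iff₀ hpos, hzn, ← sub_sub]
  exact key.trans (by gcongr)

end Distortion

theorem proposition1p4 (n : ℕ) (hn : 1 ≤ n) (f : Cn n → Cn n) (hf : f ∈ classS0 n)
    (r : ℝ) (hr : r ∈ Set.Ioo (0 : ℝ) 1) (z : Cn n) (hz : ‖z‖ ≤ r) :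
    ‖fderiv ℂ f z‖ ≤ (1 + Real.sqrt r) ^ 2 / (1 - r) ^ 3 := by
  obtain ⟨hr0, hr1⟩ := hr
  -- For `R² = r` the quotient `koebe R * R / (R² - r²)` equals `1 / ((1 - R)² (1 - R²))`, which is
  -- `(1 + R)² / (1 - r)³`.
  set R := Real.sqrt r with hRdef
  have hR2 : R ^ 2 = r := Real.sq_sqrt hr0.le
  have hR0 : 0 < R := Real.sqrt_pos.2 hr0
  have hR1 : R < 1 := by nlinarith
  have hrR : r < R := by nlinarith
  have hsub : ball (0 : Cn n) R ⊆ unitBall n := ball_subset_ball hR1.le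
  have key := norm_fderiv_mul_le_of_forall_mem_ball (hf.1.holomorphic.mono hsub)
    (fun y hy => (norm_le_koebe_of_mem_classS0 hf (hsub hy)).trans
      (koebe_mono (norm_nonneg y) (mem_ball_zero_iff.1 hy).le hR1)) (hz.trans_lt hrR)
  have hzr : R ^ 2 - r ^ 2 ≤ R ^ 2 - ‖z‖ ^ 2 := by gcongr
  have hpos : 0 < R ^ 2 - r ^ 2 := by nlinarith
  have hle : ‖fderiv ℂ f z‖ ≤ koebe R * R / (R ^ 2 - r ^ 2) := by
    rw [le_div_iff₀ hpos]
    exact (mul_le_mul_of_nonneg_left hzr (norm_nonneg _)).trans key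
  refine hle.trans_eq ?_
  rw [← hR2]
  have h1 : 1 - R ≠ 0 := by linarith
  have h2 : 1 + R ≠ 0 := by linarith
  have h3 : R ^ 2 - (R ^ 2) ^ 2 = R ^ 2 * ((1 - R) * (1 + R)) := by ring
  have h4 : (1 - R ^ 2) ^ 3 = ((1 - R) * (1 + R)) ^ 3 := by ring
  rw [h3, h4, koebe]
  field_simp
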